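/- Let $\mathbb{F}\in\{\mathbb{R},\mathbb{C},\mathbb{H}\}$, $m=\dim_{\mathbb{R}}\mathbb{F}$ and $d\ge 1$. Regard $\mathbb{F}^d$ as a right $\mathbb{F}$-vector space with $\langle v,w\rangle=\sum_j\overline{v_j}w_j$ and $\|v\|^2=\langle v,v\rangle$. Let $\sigma$ be the surface area measure on the unit sphere $\mathbb{S}\subset\mathbb{F}^d$, normalised so that $\sigma(\mathbb{S})=1$. Let $(a)_j=a(a+1)\cdots(a+j-1)$, and $$c_t(\mathbb{F}^d)=\frac{(m/2)_t}{(md/2)_t}=\prod_{j=0}^{t-1}\frac{m+2j}{md+2j}.$$ Let $\mathbb{F}P^{d-1}$ be the set of lines $[v]=v\mathbb{F}$, $v\in\mathbb{F}^d\setminus\{0\}$, put $\cos^2\theta([v],[w])=|\langle v,w\rangle|^2/(\|v\|^2\|w\|^2)$ and $\delta(p,q)=\sqrt{1-\cos^2\theta(p,q)}$, and let $\omega$ be the image of $\sigma$ under $x\mapsto[x]$. Let $\mu_m$ be the Borel probability measure on $[0,1]$ with $\int g\,d\mu_m=\int_{\mathbb{S}}\int_{\mathbb{S}}g(|\langle x,y\rangle|^2)\,d\sigma(x)\,d\sigma(y)$.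 A sequence $(Q_k)_{k\ge0}$ of real polynomials with $\deg Q_k=k$ is orthogonal for $\mu_m$ if $\int Q_jQ_k\,d\mu_m=0$ for $j\ne k$. **Theorem.** $\mathbb{F}P^{d-1}$ with the metric $\delta$ and the measure $\omega$ is a Delsarte space: $\delta$ is a metric of finite diameter, $\omega$ is a finite measure, and for all $j,k\ge0$ there is a polynomial $f_{jk}$ of degree at most $\min\{j,k\}$ with $\int\delta(a,x)^{2j}\delta(b,x)^{2k}\,d\omega(x)=f_{jk}(\delta(a,b)^2)$ for all $a,b\in\mathbb{F}P^{d-1}$. The Jacobi polynomials $$Q^{(m)}_k(x)=\frac{(m/2)_k}{k!}\sum_{j=0}^k(-1)^j\binom kj\frac{(md/2-1+k)_j}{(m/2)_j}x^j,\qquad k\ge0,$$ are orthogonal for $\mu_m$. Moreover, let $t\ge1$, let $(v_j)$ be a finite family of nonzero vectors in $\mathbb{F}^d$ with weights $w_j\ge0$, $\sum_jw_j>0$, and put $p_j=[v_j]$, $w_j'=w_j\|v_j\|^{2t}$ (so that $w_j'=w_j$ for unit vectors). Then the following are equivalent. 1. $\sum_jw_j\delta_{v_j}$ (a sum of Dirac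 measures) is a spherical $(t,t)$-design for $\mathbb{F}^d$, i.e., $\sum_{j,k}w_jw_k|\langle v_j,v_k\rangle|^{2t}=c_t(\mathbb{F}^d)\bigl(\sum_\ell w_\ell\|v_\ell\|^{2t}\bigr)^2$. 2. The points $p_j$ with the weights $w_j'$ form a (weighted) projective $t$-design on $\mathbb{F}P^{d-1}$ in the sense of Hoggar, i.e., $\sum_{j,k}w_j'w_k'\,Q_\ell(\cos^2\theta(p_j,p_k))=0$ for $\ell=1,\dots,t$, where, with ${}_j(a)=a(a-1)\cdots(a-j+1)$, $$Q_k(x)=\frac{(md/2)_{2k}}{(m/2)_k\,k!}\sum_{j=0}^k(-1)^j\binom kj\frac{{}_j(k+m/2-1)}{{}_j(2k+md/2-2)}x^{k-j}.$$ 3. $\iint g(1-\delta(x,y)^2)\,d\omega(x)\,d\omega(y)=\bigl(\sum_jw_j'\bigr)^{-2}\sum_{j,k}w_j'w_k'\,g(1-\delta(p_j,p_k)^2)$ for all real polynomials $g$ of degree at most $t$, i.e., the points $p_j$ with the weights $w_j'$ form a weighted $t$-design in the Delsarte space $(\mathbb{F}P^{d-1},\delta,\omega)$. 4. $\sum_{j,k}w_j'w_k'\,Q_\ell(\cos^2\theta(p_j,p_k))=0$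 for $\ell=1,\dots,t$, for any given sequence $(Q_k)$ of orthogonal polynomials for $\mu_m$ (the condition does not depend on its choice). -/

import Mathlib

open scoped Quaternion Polynomial LinearAlgebra.Projectivization
open MeasureTheory

noncomputable section

/-! ## The Borel structure of the quaternions -/

instance instMeasurableSpaceQuaternionReal : MeasurableSpace ℍ[ℝ] := borel ℍ[ℝ]

instance instBorelSpaceQuaternionReal : BorelSpace ℍ[ℝ] := ⟨rfl⟩

instance instSecondCountableQuaternionReal : SecondCountableTopology ℍ[ℝ] :=
  Quaternion.linearIsometryEquivTuple.toHomeomorph.secondCountableTopology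

/-! ## The Hilbert space `𝔽^d` for `𝔽 = ℝ, ℂ, ℍ` -/

/-- The space `𝔽^d` with the Euclidean norm `‖v‖² = ∑ⱼ |vⱼ|²`. -/
abbrev FVec (F : Type) [NormedDivisionRing F] (d : ℕ) : Type := PiLp 2 (fun _ : Fin d => F)

/-- The Euclidean inner product `⟨v, w⟩ = ∑ⱼ conj(vⱼ) wⱼ` with values in `𝔽`. -/
def herm {F : Type} [NormedDivisionRing F] [StarRing F] {d : ℕ} (v w : FVec F d) : F :=
  ∑ j, star (v j) * w j

/-- The surface area measure on the unit sphere of a real inner product space, normalised to have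
total mass `1`. -/
def surfaceMeasure (E : Type) [NormedAddCommGroup E] [InnerProductSpace ℝ E]
    [FiniteDimensional ℝ E] [MeasurableSpace E] [BorelSpace E] :
    Measure (Metric.sphere (0 : E) 1) :=
  ((volume : Measure E).toSphere Set.univ)⁻¹ • (volume : Measure E).toSphere

/-! ## Spherical `(t,t)`-designs -/

/-- The constant `c_t(𝔽^d) = (m/2)_t / (md/2)_t`, where `m = dim_ℝ 𝔽`; this is
`∏_{j<t} (m+2j)/(md+2j)`. -/
def designConst (m d t : ℕ) : ℝ :=
  ∏ j ∈ Finset.range t, ((m : ℝ) + 2 * j) / ((m : ℝ) * d + 2 * j)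

/-- The finitely supported measure `∑ⱼ wⱼ δ_{vⱼ}` is a spherical `(t,t)`-design for `𝔽^d`:
there is equality in the variational inequality
`∑ⱼ ∑ₖ wⱼ wₖ |⟨vⱼ, vₖ⟩|^{2t} ≥ c_t(𝔽^d) (∑ₗ wₗ ‖vₗ‖^{2t})²`. -/
def IsSphericalDesign (F : Type) [NormedDivisionRing F] [StarRing F] [NormedAlgebra ℝ F]
    {d : ℕ} (t : ℕ) {ι : Type} [Fintype ι] (w : ι → ℝ) (v : ι → FVec F d) : Prop :=
  ∑ j, ∑ k, w j * w k * ‖herm (v j) (v k)‖ ^ (2 * t) =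
    designConst (Module.finrank ℝ F) d t * (∑ l, w l * ‖v l‖ ^ (2 * t)) ^ 2

/-! ## The projective space `𝔽P^{d-1}` -/

/-- The projective space `𝔽P^{d-1}` of lines `v𝔽` in the right `𝔽`-vector space `𝔽^d`. (Right
vector spaces over `𝔽` are left vector spaces over the opposite ring.) -/
abbrev FProj (F : Type) [NormedDivisionRing F] (d : ℕ) : Type := ℙ Fᵐᵒᵖ (FVec F d)

/-- The line through a nonzero vector. -/
abbrev line {F : Type} [NormedDivisionRing F] {d : ℕ} (v : FVec F d) (hv : v ≠ 0) : FProj F d :=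
  Projectivization.mk Fᵐᵒᵖ v hv

/-- The line through a unit vector. -/
def lineOfSphere (F : Type) [NormedDivisionRing F] (d : ℕ)
    (x : Metric.sphere (0 : FVec F d) 1) : FProj F d :=
  line (x : FVec F d) (ne_zero_of_mem_unit_sphere x)

/-- The angle `cos² θ = |⟨x, y⟩|² / (‖x‖² ‖y‖²)` between two lines `x𝔽` and `y𝔽`; see
`cosSq_line` for the independence of the choice of `x` and `y`. -/
def cosSq {F : Type} [NormedDivisionRing F] [StarRing F] {d : ℕ} (p q : FProj F d) : ℝ :=
  ‖herm p.rep q.rep‖ ^ 2 / (‖p.rep‖ ^ 2 * ‖q.rep‖ ^ 2)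

theorem norm_herm_smul_smul {F : Type} [NormedDivisionRing F] [StarRing F] [NormedStarGroup F]
    {d : ℕ} (v w : FVec F d) (a b : Fᵐᵒᵖ) :
    ‖herm (a • v) (b • w)‖ = ‖a‖ * ‖b‖ * ‖herm v w‖ := by
  have h : herm (a • v) (b • w) = star a.unop * herm v w * b.unop := by
    simp only [herm, PiLp.smul_apply, MulOpposite.smul_eq_mul_unop, star_mul, Finset.mul_sum,
      Finset.sum_mul, mul_assoc]
  rw [h, norm_mul, norm_mul, norm_star, MulOpposite.norm_unop, MulOpposite.norm_unop]
  ring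

theorem norm_op_smul_sq {F : Type} [NormedDivisionRing F] {d : ℕ} (v : FVec F d) (a : Fᵐᵒᵖ) :
    ‖a • v‖ ^ 2 = ‖a‖ ^ 2 * ‖v‖ ^ 2 := by
  rw [PiLp.norm_sq_eq_of_L2, PiLp.norm_sq_eq_of_L2, Finset.mul_sum]
  refine Finset.sum_congr rfl fun i _ => ?_
  rw [PiLp.smul_apply, MulOpposite.smul_eq_mul_unop, norm_mul, MulOpposite.norm_unop]
  ring

theorem cosSq_line {F : Type} [NormedDivisionRing F] [StarRing F] [NormedStarGroup F] {d : ℕ}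
    (v w : FVec F d) (hv : v ≠ 0) (hw : w ≠ 0) :
    cosSq (line v hv) (line w hw) = ‖herm v w‖ ^ 2 / (‖v‖ ^ 2 * ‖w‖ ^ 2) := by
  obtain ⟨a, ha⟩ := Projectivization.exists_smul_eq_mk_rep Fᵐᵒᵖ v hv
  obtain ⟨b, hb⟩ := Projectivization.exists_smul_eq_mk_rep Fᵐᵒᵖ w hw
  rw [Units.smul_def] at ha hb
  have ha0 : ‖(a : Fᵐᵒᵖ)‖ ≠ 0 := norm_ne_zero_iff.2 a.ne_zero
  have hb0 : ‖(b : Fᵐᵒᵖ)‖ ≠ 0 := norm_ne_zero_iff.2 b.ne_zero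
  have hv0 : ‖v‖ ≠ 0 := norm_ne_zero_iff.2 hv
  have hw0 : ‖w‖ ≠ 0 := norm_ne_zero_iff.2 hw
  simp only [cosSq, line]
  rw [← ha, ← hb, norm_herm_smul_smul, norm_op_smul_sq, norm_op_smul_sq]
  field_simp

/-- The distance `d([x], [y]) = √(1 - |⟨x, y⟩|²)` (for unit vectors `x`, `y`) between lines. -/
def lineDist {F : Type} [NormedDivisionRing F] [StarRing F] {d : ℕ} (p q : FProj F d) : ℝ :=
  Real.sqrt (1 - cosSq p q)

/-- The quotient `σ`-algebra on `𝔽P^{d-1}`, for the quotient map from the unit sphere. -/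
instance instMeasurableSpaceFProj (F : Type) [NormedDivisionRing F] (d : ℕ)
    [MeasurableSpace (FVec F d)] : MeasurableSpace (FProj F d) :=
  MeasurableSpace.map (lineOfSphere F d) inferInstance

/-- The measure `ω` on `𝔽P^{d-1}` induced by the normalised surface area measure of the sphere. -/
def projMeasure (F : Type) [NormedDivisionRing F] (d : ℕ) [InnerProductSpace ℝ (FVec F d)]
    [FiniteDimensional ℝ (FVec F d)] [MeasurableSpace (FVec F d)] [BorelSpace (FVec F d)] :
    Measure (FProj F d) :=
  (surfaceMeasure (FVec F d)).map (lineOfSphere F d)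

/-! ## Delsarte spaces and their designs -/

/-- `X` with the metric `δ` and the measure `ω` is a Delsarte space. -/
structure IsDelsarteSpace {X : Type} [MeasurableSpace X] (δ : X → X → ℝ) (ω : Measure X) :
    Prop where
  /-- `δ` is a metric -/
  self : ∀ x, δ x x = 0
  eq_of_zero : ∀ x y, δ x y = 0 → x = y
  symm : ∀ x y, δ x y = δ y x
  triangle : ∀ x y z, δ x z ≤ δ x y + δ y z
  /-- of finite diameter -/
  bounded : ∃ D : ℝ, ∀ x y, δ x y ≤ D
  measurable : ∀ a, Measurable (δ a)
  /-- `ω` is a finite measure -/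
  finite : IsFiniteMeasure ω
  /-- `∫ δ(a,x)^{2j} δ(b,x)^{2k} dω(x)` is a polynomial of degree at most `min j k` in `δ(a,b)²` -/
  moments : ∀ j k : ℕ, ∃ f : ℝ[X], f.natDegree ≤ min j k ∧
    ∀ a b, ∫ x, δ a x ^ (2 * j) * δ b x ^ (2 * k) ∂ω = f.eval (δ a b ^ 2)

/-- The points `pⱼ` with weights `wⱼ` form a weighted `t`-design in `(X, δ, ω)` with respect to the
substitution `s`: the cubature rule
`∬ g(s(δ(x,y))) dω(x) dω(y) = (∑ⱼ wⱼ)⁻² ∑ⱼ ∑ₖ wⱼ wₖ g(s(δ(pⱼ,pₖ)))`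
holds for all univariate real polynomials `g` of degree at most `t`. -/
def IsCubatureDesign {X : Type} [MeasurableSpace X] (δ : X → X → ℝ) (ω : Measure X) (s : ℝ → ℝ)
    (t : ℕ) {ι : Type} [Fintype ι] (w : ι → ℝ) (p : ι → X) : Prop :=
  ∀ g : ℝ[X], g.natDegree ≤ t →
    ∫ x, ∫ y, g.eval (s (δ x y)) ∂ω ∂ω =
      ((∑ j, w j) ^ 2)⁻¹ * ∑ j, ∑ k, w j * w k * g.eval (s (δ (p j) (p k)))

/-! ## Orthogonal polynomials and projective `t`-designs -/

/-- The measure `μ_m` on `[0,1] ⊆ ℝ`: the distribution of `|⟨x, y⟩|²` for `x`, `y` independent and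
uniformly distributed on the unit sphere of `𝔽^d`. -/
def inducedMeasure (F : Type) [NormedDivisionRing F] [StarRing F] (d : ℕ)
    [InnerProductSpace ℝ (FVec F d)] [FiniteDimensional ℝ (FVec F d)]
    [MeasurableSpace (FVec F d)] [BorelSpace (FVec F d)] : Measure ℝ :=
  ((surfaceMeasure (FVec F d)).prod (surfaceMeasure (FVec F d))).map
    (fun z => ‖herm (z.1 : FVec F d) (z.2 : FVec F d)‖ ^ 2)

/-- `Q 0, Q 1, …` are orthogonal polynomials for `μ`, with `Q k` of degree `k`. -/
def IsOrthogonalFamily (μ : Measure ℝ) (Q : ℕ → ℝ[X]) : Prop :=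
  (∀ k, (Q k).degree = k) ∧
    ∀ j k, j ≠ k → ∫ s, (Q j).eval s * (Q k).eval s ∂μ = 0

/-- The Jacobi polynomial `P_k^{(α,β)}(1 - 2x)` for `α = m/2 - 1` and `β = m(d-1)/2 - 1`, i.e.
`(m/2)_k / k! ∑_{j ≤ k} (-1)^j (k choose j) (md/2 - 1 + k)_j / (m/2)_j x^j`, where
`(a)_j = a (a+1) ⋯ (a+j-1)`. -/
def jacobiPoly (m d k : ℕ) : ℝ[X] :=
  Polynomial.C ((ascPochhammer ℝ k).eval ((m : ℝ) / 2) / (k.factorial : ℝ)) *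
    ∑ j ∈ Finset.range (k + 1),
      Polynomial.C ((-1) ^ j * (k.choose j : ℝ) *
        (ascPochhammer ℝ j).eval ((m : ℝ) * d / 2 - 1 + k) /
          (ascPochhammer ℝ j).eval ((m : ℝ) / 2)) * Polynomial.X ^ j

/-- Hoggar's polynomial
`(md/2)_{2k} / ((m/2)_k k!) ∑_{j ≤ k} (-1)^j (k choose j)
  ₍ⱼ₎(k + m/2 - 1) / ₍ⱼ₎(2k + md/2 - 2) x^{k-j}`,
where `(a)_j = a (a+1) ⋯ (a+j-1)` and `₍ⱼ₎(a) = a (a-1) ⋯ (a-j+1)`. -/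
def hoggarPoly (m d k : ℕ) : ℝ[X] :=
  Polynomial.C ((ascPochhammer ℝ (2 * k)).eval ((m : ℝ) * d / 2) /
      ((ascPochhammer ℝ k).eval ((m : ℝ) / 2) * (k.factorial : ℝ))) *
    ∑ j ∈ Finset.range (k + 1),
      Polynomial.C ((-1) ^ j * (k.choose j : ℝ) *
        (descPochhammer ℝ j).eval ((k : ℝ) + (m : ℝ) / 2 - 1) /
          (descPochhammer ℝ j).eval (2 * (k : ℝ) + (m : ℝ) * d / 2 - 2)) *
        Polynomial.X ^ (k - j)

/-- `∑ⱼ ∑ₖ wⱼ wₖ Q_ℓ(cos² θ(pⱼ, pₖ)) = 0` for `1 ≤ ℓ ≤ t`. -/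
def DesignSumsVanish {F : Type} [NormedDivisionRing F] [StarRing F] {d : ℕ} (Q : ℕ → ℝ[X])
    (t : ℕ) {ι : Type} [Fintype ι] (w : ι → ℝ) (p : ι → FProj F d) : Prop :=
  ∀ l : ℕ, 1 ≤ l → l ≤ t → ∑ j, ∑ k, w j * w k * (Q l).eval (cosSq (p j) (p k)) = 0

/-- The points `pⱼ` of `𝔽P^{d-1}` with weights `wⱼ` form a projective `t`-design, in the sense of
Hoggar. (For an injective family and weights `wⱼ = 1` it is the notion for finite sets.) -/
def IsProjectiveDesign (F : Type) [NormedDivisionRing F] [StarRing F] [NormedAlgebra ℝ F]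
    {d : ℕ} (t : ℕ) {ι : Type} [Fintype ι] (w : ι → ℝ) (p : ι → FProj F d) : Prop :=
  DesignSumsVanish (hoggarPoly (Module.finrank ℝ F) d) t w p

end

/-! ### The common structure of `ℝ`, `ℂ` and `ℍ`. -/

noncomputable section

/-! Everything rests on the moments `∫ |⟨x, y⟩|^{2r} dσ(x) = c_r ‖y‖^{2r}`. Unitary maps act
transitively on the sphere, so the integral is a multiple of `‖y‖^{2r}`. Applying the Laplacian in
`y` to both sides gives the ratio `c_{r+1} / c_r = (m + 2r) / (md + 2r)` (`functional_hermSq_pow`,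
`integral_norm_herm_pow`).

Designs. The kernel `|⟨x, y⟩|^{2t}` is an inner product of feature vectors `φ(x)`, `φ(y)`. With `W =
∑ wⱼ‖vⱼ‖^{2t}`, condition 1 says that `∑ wⱼ φ(vⱼ)` and `W ∫ φ dσ` are at distance zero. Hence `∑ wⱼ
|⟨vⱼ, y⟩|^{2t} = W c_t ‖y‖^{2t}` for every `y` (`sum_norm_herm_pow_of_design`). The same Laplacian
lowers `t` to any `r ≤ t`, at the cost of a factor `‖vⱼ‖^{2(t-r)}` in the weights
(`design_sum_of_le`). In terms of lines and the weights `w'` this is exactness of the cubature rule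
for `X^r`. So condition 1, which is exactness for `X^t`, amounts to vanishing of the linear
functional `cubatureError` in all degrees up to `t`; this is condition 3. Testing it on orthogonal
polynomials instead of monomials gives condition 4, because constants are always integrated exactly
and `Q_ℓ` has mean zero for `ℓ ≥ 1`. Orthogonality of the Jacobi polynomials follows from the
moments by a finite difference argument, and Hoggar's polynomials of positive degree are nonzero
multiples of them.

Delsarte property. `δ` is the distance from a unit vector of one line to the other line, whence the
triangle inequality. A two-point integral depends only on `|⟨a, b⟩|`. Moving `b` to `r e + s e'`
with `r² + s² = 1` and averaging over the sign of `s` turns it into a polynomial in `r²` of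
controlled degree (`exists_twoPoint_moment`). -/

/-- A normed division ring whose norm comes from a real inner product for which left and right
multiplications have the expected adjoints: the common features of `ℝ`, `ℂ` and `ℍ`. -/
class EuclideanDivisionRing (F : Type) [NormedDivisionRing F] [StarRing F]
    [InnerProductSpace ℝ F] : Prop extends IsScalarTower ℝ F F, SMulCommClass ℝ F F,
    StarModule ℝ F, NormedStarGroup F where
  star_mul_self_eq : ∀ a : F, star a * a = (‖a‖ ^ 2 : ℝ) • (1 : F)
  add_star_eq : ∀ a : F, a + star a = (2 * inner ℝ 1 a : ℝ) • (1 : F)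
  inner_mul_left_eq : ∀ a b c : F, inner ℝ (a * b) c = inner ℝ b (star a * c)
  inner_mul_right_eq : ∀ a b c : F, inner ℝ (a * b) c = inner ℝ a (c * star b)

instance : EuclideanDivisionRing ℝ where
  star_mul_self_eq a := by simp [pow_two]
  add_star_eq a := by simp [two_mul]
  inner_mul_left_eq a b c := by simp; ring
  inner_mul_right_eq a b c := by simp; ring

instance : EuclideanDivisionRing ℂ where
  star_mul_self_eq a := by
    simp [← Complex.normSq_eq_norm_sq, ← Complex.normSq_eq_conj_mul_self]
  add_star_eq a := by simp [Complex.add_conj, Complex.inner]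
  inner_mul_left_eq a b c := by simp [Complex.inner]; ring
  inner_mul_right_eq a b c := by simp [Complex.inner]; ring

instance : NormedStarGroup ℍ[ℝ] := ⟨fun a => (Quaternion.norm_star a).le⟩

instance : EuclideanDivisionRing ℍ[ℝ] where
  star_smul r a := by simp
  star_mul_self_eq a := by
    rw [Quaternion.star_mul_self, pow_two, ← Quaternion.normSq_eq_norm_mul_self]
    ext <;> simp
  add_star_eq a := by
    rw [Quaternion.inner_def]
    ext <;> simp [two_mul]
  inner_mul_left_eq a b c := by simp [Quaternion.inner_def]; ring
  inner_mul_right_eq a b c := by simp [Quaternion.inner_def]; ring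

/-! ### The hermitian form and its unitary maps. -/

section Herm

open MulOpposite (op)

variable {F : Type} [NormedDivisionRing F] {d : ℕ}

theorem norm_op_smul (a : F) (v : FVec F d) : ‖op a • v‖ = ‖a‖ * ‖v‖ := by
  have := norm_op_smul_sq v (op a)
  rw [← mul_pow, MulOpposite.norm_op] at this
  exact (pow_left_inj₀ (norm_nonneg _) (by positivity) two_ne_zero).1 this

variable [StarRing F]

theorem herm_add_right (v x y : FVec F d) : herm v (x + y) = herm v x + herm v y := by
  simp [herm, mul_add, Finset.sum_add_distrib]

theorem herm_sub_right (v x y : FVec F d) : herm v (x - y) = herm v x - herm v y := by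
  simp [herm, mul_sub, Finset.sum_sub_distrib]

theorem herm_sub_left (x y v : FVec F d) : herm (x - y) v = herm x v - herm y v := by
  simp [herm, sub_mul, Finset.sum_sub_distrib]

theorem herm_op_smul_right (v x : FVec F d) (a : F) : herm v (op a • x) = herm v x * a := by
  simp [herm, Finset.sum_mul, mul_assoc]

theorem herm_op_smul_left (v x : FVec F d) (a : F) : herm (op a • v) x = star a * herm v x := by
  simp [herm, Finset.mul_sum, mul_assoc]

theorem star_herm (v x : FVec F d) : star (herm v x) = herm x v := by
  simp [herm]

variable [InnerProductSpace ℝ F] [EuclideanDivisionRing F]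

theorem herm_smul_right (v x : FVec F d) (r : ℝ) : herm v (r • x) = r • herm v x := by
  simp [herm, Finset.smul_sum, mul_smul_comm]

theorem herm_smul_left (v x : FVec F d) (r : ℝ) : herm (r • v) x = r • herm v x := by
  simp [herm, Finset.smul_sum, star_smul, smul_mul_assoc]

theorem norm_herm_comm (v x : FVec F d) : ‖herm v x‖ = ‖herm x v‖ := by
  rw [← star_herm, norm_star]

/-- The maps `f ↦ x f` and `y ↦ ⟨x, y⟩` are adjoint for the real inner products. -/
theorem inner_herm (f : F) (x y : FVec F d) :
    inner ℝ f (herm x y) = inner ℝ (op f • x) y := by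
  simp [herm, inner_sum, PiLp.inner_apply, EuclideanDivisionRing.inner_mul_left_eq]

theorem herm_self (v : FVec F d) : herm v v = (‖v‖ ^ 2 : ℝ) • (1 : F) := by
  simp [herm, EuclideanDivisionRing.star_mul_self_eq, PiLp.norm_sq_eq_of_L2, Finset.sum_smul]

theorem inner_one_herm (x y : FVec F d) : inner ℝ 1 (herm x y) = inner ℝ x y := by
  simp [inner_herm]

/-- Pythagoras: the point of the line `x𝔽` nearest to `y` is `x⟨x, y⟩`. This yields both the
Cauchy–Schwarz inequality and the metric on lines. -/
theorem norm_sub_op_smul_sq (x y : FVec F d) (hx : ‖x‖ = 1) (a : F) :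
    ‖y - op a • x‖ ^ 2 = ‖y‖ ^ 2 - ‖herm x y‖ ^ 2 + ‖herm x y - a‖ ^ 2 := by
  rw [norm_sub_sq_real, norm_sub_sq_real, real_inner_comm, ← inner_herm, norm_op_smul, hx,
    real_inner_comm]
  ring

theorem norm_herm_le (x y : FVec F d) : ‖herm x y‖ ≤ ‖x‖ * ‖y‖ := by
  by_cases hx : x = 0
  · simp [hx, herm]
  have hx' : ‖x‖ ≠ 0 := norm_ne_zero_iff.2 hx
  have h := norm_sub_op_smul_sq (‖x‖⁻¹ • x) y (by rw [norm_smul]; simp [hx']) (herm (‖x‖⁻¹ • x) y)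
  rw [herm_smul_left, norm_smul, sub_self, norm_zero, norm_inv, norm_norm] at h
  have h2 : (‖x‖⁻¹ * ‖herm x y‖) ^ 2 ≤ ‖y‖ ^ 2 := by
    nlinarith [sq_nonneg ‖y - op (‖x‖⁻¹ • herm x y) • ‖x‖⁻¹ • x‖]
  have h3 := (pow_le_pow_iff_left₀ (by positivity) (by positivity) two_ne_zero).1 h2
  rwa [inv_mul_le_iff₀ (by positivity)] at h3

/-- Taylor expansion of `|⟨x, ·⟩|²`: its gradient at `y` is `2 x⟨x, y⟩`. -/
theorem norm_herm_add_smul_sq (x y e : FVec F d) (s : ℝ) :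
    ‖herm x (y + s • e)‖ ^ 2 = ‖herm x y‖ ^ 2 + 2 * s * inner ℝ (op (herm x y) • x) e
      + s ^ 2 * ‖herm x e‖ ^ 2 := by
  rw [herm_add_right, herm_smul_right, norm_add_sq_real, inner_smul_right, inner_herm, norm_smul,
    mul_pow, Real.norm_eq_abs, sq_abs]
  ring

theorem continuous_herm : Continuous fun z : FVec F d × FVec F d => herm z.1 z.2 := by
  unfold herm
  fun_prop

/-! ### Unitary reflections -/

/-- The reflection-like map taking the unit vector `a` to the unit vector `b`. -/
theorem exists_unitary (a b : FVec F d) (ha : ‖a‖ = 1) (hb : ‖b‖ = 1) :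
    ∃ T : FVec F d →ₗ[ℝ] FVec F d, (∀ x y, herm (T x) (T y) = herm x y) ∧
      (∀ (c : F) x, T (op c • x) = op c • T x) ∧ T a = b ∧
      ∀ x, herm a x = 0 → herm b x = 0 → T x = x := by
  by_cases hz : herm b a = 1
  · refine ⟨LinearMap.id, by simp, by simp, ?_, by simp⟩
    have := norm_sub_op_smul_sq b a hb 1
    simp [hz, ha] at this
    simpa using sub_eq_zero.1 this
  -- The map is `T x = x - (b - a) z⁻¹ ⟨b - a, x⟩`, over `ℝ` the Householder reflection. Since `⟨b -
  -- a, a⟩ = -z`, it sends `a` to `b`. Since `⟨b - a, b - a⟩ = z + star z`, unitarity is the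
  -- identity `key`.
  set z : F := 1 - herm b a with hzdef
  have hz0 : z ≠ 0 := fun h => hz (sub_eq_zero.1 h).symm
  have hsz : star z = 1 - herm a b := by simp [hzdef, star_herm]
  have hua : herm (b - a) a = -z := by rw [herm_sub_left, herm_self a, ha]; simp [hzdef]
  have huu : herm (b - a) (b - a) = z + star z := by
    rw [herm_sub_right, hua, herm_sub_left, herm_self b, hb, hsz]; simp; abel
  have key : star z⁻¹ * (z + star z) * z⁻¹ = z⁻¹ + star z⁻¹ := by
    have h2 : star z ≠ 0 := by simpa using hz0
    rw [star_inv₀, mul_add, add_mul, mul_assoc, mul_inv_cancel₀ hz0, inv_mul_cancel₀ h2]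
    simp [add_comm]
  refine ⟨{ toFun := fun x => x - op (z⁻¹ * herm (b - a) x) • (b - a)
            map_add' := fun x y => by
              rw [herm_add_right, mul_add, MulOpposite.op_add, add_smul]; abel
            map_smul' := fun r x => by
              rw [herm_smul_right, mul_smul_comm, MulOpposite.op_smul, smul_assoc]
              simp [smul_sub] }, ?_, ?_, ?_, ?_⟩
  · intro x y
    simp only [LinearMap.coe_mk, AddHom.coe_mk, herm_sub_left _ _ (y - _),
      herm_sub_right _ y, herm_op_smul_left, herm_op_smul_right, star_mul]
    have h1 : star (herm (b - a) x) = herm x (b - a) := star_herm _ _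
    rw [huu, h1]
    have h3 : herm x (b - a) * star z⁻¹ * ((z + star z) * (z⁻¹ * herm (b - a) y))
      = herm x (b - a) * (star z⁻¹ * (z + star z) * z⁻¹) * herm (b - a) y := by
      simp only [mul_assoc]
    rw [mul_assoc (herm x (b - a) * star z⁻¹), h3, key]
    noncomm_ring
  · intro c x
    simp only [LinearMap.coe_mk, AddHom.coe_mk, herm_op_smul_right, smul_sub, smul_smul]
    simp [mul_assoc]
  · simp only [LinearMap.coe_mk, AddHom.coe_mk, hua, mul_neg, inv_mul_cancel₀ hz0]
    simp
  · intro x h1 h2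
    simp [herm_sub_left, h1, h2]

end Herm

/-! ### Functionals on coefficients, and second-order coefficients of powers. -/

open Polynomial in
/-- Apply a linear functional to the coefficients of a polynomial. -/
def coeffMap {R : Type*} [CommRing R] [Algebra ℝ R] (L : R →ₗ[ℝ] ℝ) (p : R[X]) : ℝ[X] :=
  ∑ n ∈ Finset.range (p.natDegree + 1), monomial n (L (p.coeff n))

section CoeffMap

open Polynomial

variable {R : Type*} [CommRing R] [Algebra ℝ R]

theorem coeff_coeffMap (L : R →ₗ[ℝ] ℝ) (p : R[X]) (n : ℕ) :
    (coeffMap L p).coeff n = L (p.coeff n) := by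
  simp only [coeffMap, finsetSum_coeff, coeff_monomial, Finset.sum_ite_eq', Finset.mem_range]
  split_ifs with h
  · rfl
  · rw [coeff_eq_zero_of_natDegree_lt (by omega), map_zero]

theorem natDegree_coeffMap_le (L : R →ₗ[ℝ] ℝ) (p : R[X]) :
    (coeffMap L p).natDegree ≤ p.natDegree :=
  natDegree_le_iff_coeff_eq_zero.2 fun n hn => by
    rw [coeff_coeffMap, coeff_eq_zero_of_natDegree_lt hn, map_zero]

theorem eval_coeffMap (L : R →ₗ[ℝ] ℝ) (p : R[X]) (s : ℝ) :
    (coeffMap L p).eval s = L (p.eval (algebraMap ℝ R s)) := by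
  rw [coeffMap, eval_finsetSum, eval_eq_sum_range, map_sum]
  refine Finset.sum_congr rfl fun n _ => ?_
  rw [eval_monomial, ← map_pow, mul_comm (p.coeff n), ← Algebra.smul_def, map_smul, smul_eq_mul,
    mul_comm]

/-- Comparing coefficients in a real parameter replaces differentiation under `L`, so no continuity
of `L` is needed. -/
theorem coeff_eq_of_eval_eq (L : R →ₗ[ℝ] ℝ) (p : R[X]) (q : ℝ[X])
    (h : ∀ s : ℝ, L (p.eval (algebraMap ℝ R s)) = q.eval s) (n : ℕ) :
    L (p.coeff n) = q.coeff n := by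
  rw [← coeff_coeffMap]
  congr 1
  exact Polynomial.funext fun s => by rw [eval_coeffMap, h]

omit [Algebra ℝ R] in
theorem coeff_two_quadratic_pow (a b c : R) (t : ℕ) :
    ((C a + C b * X + C c * X ^ 2) ^ (t + 2)).coeff 2 =
      (t + 2) * a ^ (t + 1) * c + (t + 2).choose 2 * a ^ t * b ^ 2 := by
  have h0 : ∀ t : ℕ, ((C a + C b * X + C c * X ^ 2) ^ t).coeff 0 = a ^ t := fun t => by
    simp [coeff_zero_eq_eval_zero]
  have h1 : ∀ t : ℕ, ((C a + C b * X + C c * X ^ 2) ^ (t + 1)).coeff 1 =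
      (t + 1) * a ^ t * b := by
    intro t
    induction t with
    | zero => simp [coeff_C, coeff_X_pow]
    | succ t ih =>
      rw [pow_succ, coeff_mul, Finset.Nat.sum_antidiagonal_eq_sum_range_succ_mk]
      simp only [Finset.sum_range_succ, Finset.sum_range_zero, ih, h0]
      simp [coeff_C, coeff_X_pow]
      ring
  have h2 : ∀ t : ℕ, ((C a + C b * X + C c * X ^ 2) ^ (t + 1)).coeff 2 * a ^ 0 =
      ((C a + C b * X + C c * X ^ 2) ^ t).coeff 2 * a + t * a ^ (t - 1) * b ^ 2 + a ^ t * c := by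
    intro t
    rw [pow_succ, coeff_mul, Finset.Nat.sum_antidiagonal_eq_sum_range_succ_mk]
    cases t with
    | zero => simp [coeff_X, coeff_C, coeff_one]
    | succ t =>
      simp only [Finset.sum_range_succ, Finset.sum_range_zero, h1, h0]
      simp [coeff_X, coeff_C, coeff_X_pow]
      ring
  induction t with
  | zero =>
    have := h2 1
    have h3 : (C a + C b * X + C c * X ^ 2).coeff 2 = c := by simp
    simp [h3] at this
    simp [this]; ring
  | succ t ih =>
    have := h2 (t + 2)
    rw [ih] at this
    rw [pow_zero, mul_one] at this
    rw [show t + 1 + 2 = t + 2 + 1 by ring, this, Nat.choose_succ_succ' (t + 2) 1]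
    simp
    ring

-- An algebraic form of the Laplacian of `q^(t+1)`, for a quadratic form `q` with value `a` at a
-- point. Expanding `q` along each basis direction gives `a + bᵢ s + cᵢ s²`; the hypotheses say
-- `|∇q|² = 4 q g` and `Δq / 2 = m g`. They hold for `q = |⟨x, ·⟩|²` with `g = ‖x‖²`, `m = dim 𝔽`,
-- and for `q = ‖·‖²` with `g = 1`, `m` replaced by `dim 𝔽^d`.
omit [Algebra ℝ R] in
theorem sum_coeff_two_quadratic_pow {ι : Type*} [Fintype ι] (a g m : R) (b c : ι → R)
    (hb : ∑ i, b i ^ 2 = 4 * a * g) (hc : ∑ i, c i = m * g) (t : ℕ) :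
    ∑ i, ((C a + C (b i) * X + C (c i) * X ^ 2) ^ (t + 1)).coeff 2 =
      (t + 1) * (m + 2 * t) * (a ^ t * g) := by
  cases t with
  | zero => simp [hc]
  | succ t =>
    simp only [coeff_two_quadratic_pow, Finset.sum_add_distrib, ← Finset.mul_sum, hb, hc]
    have h : 2 * ((t + 2).choose 2 : R) = (t + 2) * (t + 1) := by
      have := Nat.choose_two_right (t + 2)
      have h2 : 2 * (t + 2).choose 2 = (t + 2) * (t + 1) := by
        rw [this, Nat.mul_div_cancel']
        · rfl
        · exact (Nat.even_mul_pred_self (t + 2)).two_dvd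
      exact_mod_cast congrArg (Nat.cast : ℕ → R) h2
    push_cast
    linear_combination 2 * a ^ (t + 1) * g * h

end CoeffMap

/-! ### Lowering the degree by the Laplacian. -/

section Laplacian

variable {F : Type} [NormedDivisionRing F] [StarRing F] [InnerProductSpace ℝ F]
  [EuclideanDivisionRing F] [FiniteDimensional ℝ F] {d : ℕ}

open MulOpposite (op)

theorem sum_inner_stdBasis_sq {E : Type*} [NormedAddCommGroup E] [InnerProductSpace ℝ E]
    [FiniteDimensional ℝ E] (x : E) :
    ∑ i, inner ℝ x (stdOrthonormalBasis ℝ E i) ^ 2 = ‖x‖ ^ 2 := by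
  rw [← (stdOrthonormalBasis ℝ E).sum_sq_norm_inner_left x]
  simp

/-- Half the Laplacian of `|⟨x, ·⟩|²`. In an orthonormal basis `f_k` of `𝔽` the coordinates of `⟨x,
eᵢ⟩` are the inner products of `x f_k` with `eᵢ`; summing over `i` first gives `‖x f_k‖² = ‖x‖²` for
each `k`. -/
theorem sum_norm_herm_stdBasis_sq (x : FVec F d) :
    ∑ i, ‖herm x (stdOrthonormalBasis ℝ (FVec F d) i)‖ ^ 2 = Module.finrank ℝ F * ‖x‖ ^ 2 := by
  have h : ∀ f : F, ‖f‖ ^ 2 = ∑ k, inner ℝ (stdOrthonormalBasis ℝ F k) f ^ 2 := fun f => by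
    rw [← sum_inner_stdBasis_sq]
    simp only [real_inner_comm]
  simp only [h, inner_herm]
  rw [Finset.sum_comm]
  simp [sum_inner_stdBasis_sq, norm_op_smul]

variable {Ω : Type*} [TopologicalSpace Ω]

/-- The function `ω ↦ |⟨φ ω, y⟩|²`. -/
def hermSq (φ : C(Ω, FVec F d)) (y : FVec F d) : C(Ω, ℝ) where
  toFun ω := ‖herm (φ ω) y‖ ^ 2
  continuous_toFun := by
    have := (continuous_herm (F := F) (d := d)).comp
      (φ.continuous.prodMk (continuous_const (y := y)))
    exact (continuous_norm.comp this).pow 2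

/-- The function `ω ↦ ‖φ ω‖²`. -/
def normSqMap (φ : C(Ω, FVec F d)) : C(Ω, ℝ) where
  toFun ω := ‖φ ω‖ ^ 2

/-- The polarisation of `hermSq`. -/
def hermPolar (φ : C(Ω, FVec F d)) (y e : FVec F d) : C(Ω, ℝ) where
  toFun ω := 2 * inner ℝ (herm (φ ω) y) (herm (φ ω) e)
  continuous_toFun := by
    have h := fun z : FVec F d => (continuous_herm (F := F) (d := d)).comp
      (φ.continuous.prodMk (continuous_const (y := z)))
    exact ((h y).inner (h e)).const_mul 2

/-- The Laplacian in `y` applied to both sides of `h`. Stating it for an arbitrary functional `L`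
covers both the integral over the sphere and a weighted finite sum. -/
theorem functional_hermSq_pow (φ : C(Ω, FVec F d)) (L : C(Ω, ℝ) →ₗ[ℝ] ℝ) (K : ℝ) (t : ℕ)
    (h : ∀ y, L (hermSq φ y ^ (t + 1)) = K * ‖y‖ ^ (2 * (t + 1))) (y : FVec F d) :
    (Module.finrank ℝ F + 2 * t) * L (hermSq φ y ^ t * normSqMap φ) =
      K * (Module.finrank ℝ F * d + 2 * t) * ‖y‖ ^ (2 * t) := by
  set e := stdOrthonormalBasis ℝ (FVec F d)
  open Polynomial in
  -- The coefficient of `s²` in the hypothesis at `y + s eᵢ`.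
  have h1 : ∀ i, L (((C (hermSq φ y) + C (hermPolar φ y (e i)) * X +
      C (hermSq φ (e i)) * X ^ 2) ^ (t + 1)).coeff 2) =
      K * ((C (‖y‖ ^ 2) + C (2 * inner ℝ y (e i)) * X + C 1 * X ^ 2) ^ (t + 1)).coeff 2 := by
    intro i
    rw [← coeff_C_mul]
    refine coeff_eq_of_eval_eq L _ _ (fun s => ?_) 2
    have h2 := h (y + s • e i)
    have h3 : hermSq φ (y + s • e i) = hermSq φ y + hermPolar φ y (e i) * algebraMap ℝ _ s +
        hermSq φ (e i) * (algebraMap ℝ _ s) ^ 2 := by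
      ext ω
      simp [hermSq, hermPolar, norm_herm_add_smul_sq, inner_herm]
      ring
    rw [h3, pow_mul, norm_add_sq_real, inner_smul_right, norm_smul, mul_pow,
      e.norm_eq_one] at h2
    simp only [eval_pow, eval_add, eval_mul, eval_C, eval_X]
    rw [h2, Real.norm_eq_abs, sq_abs]
    ring
  have h2 := Finset.sum_congr (rfl : Finset.univ = Finset.univ) fun i _ => h1 i
  rw [← map_sum, ← Finset.mul_sum, sum_coeff_two_quadratic_pow _ (normSqMap φ)
    ((Module.finrank ℝ F : ℝ) • 1), sum_coeff_two_quadratic_pow _ 1 (Module.finrank ℝ F * d : ℝ)]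
    at h2
  · have h3 : ((t : C(Ω, ℝ)) + 1) * ((Module.finrank ℝ F : ℝ) • 1 + 2 * (t : C(Ω, ℝ))) *
        (hermSq φ y ^ t * normSqMap φ) = ((t + 1 : ℝ) * (Module.finrank ℝ F + 2 * t)) •
          (hermSq φ y ^ t * normSqMap φ) := by
      have h5 : ∀ ω, (2 : C(Ω, ℝ)) ω = 2 := fun _ => rfl
      ext ω; simp [h5]
    rw [h3, map_smul, smul_eq_mul] at h2
    have h4 : (t + 1 : ℝ) ≠ 0 := by positivity
    refine mul_left_cancel₀ h4 ?_
    rw [← mul_assoc, h2, pow_mul]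
    ring
  · simp only [mul_pow, ← Finset.mul_sum, e, sum_inner_stdBasis_sq]; norm_num
  · have h3 : Module.finrank ℝ (FVec F d) = d * Module.finrank ℝ F := by
      rw [(WithLp.linearEquiv 2 ℝ (Fin d → F)).finrank_eq]
      simp [Module.finrank_pi_fintype]
    simp [h3, mul_comm]
  · ext ω
    simp [mul_pow, ← Finset.mul_sum, hermPolar, hermSq, normSqMap, inner_herm, e,
      sum_inner_stdBasis_sq, norm_op_smul]
    have h5 : ∀ ω, (4 : C(Ω, ℝ)) ω = 4 := fun _ => rfl
    rw [h5]
    ring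
  · ext ω
    simp [hermSq, normSqMap, e, sum_norm_herm_stdBasis_sq]

theorem designConst_succ (m d t : ℕ) : designConst m d (t + 1) =
    designConst m d t * ((m + 2 * t) / (m * d + 2 * t)) := by
  rw [designConst, Finset.prod_range_succ, ← designConst]

theorem functional_hermSq_descent (hd : 1 ≤ d) (φ : C(Ω, FVec F d)) (W : ℝ) (r k : ℕ)
    (L : C(Ω, ℝ) →ₗ[ℝ] ℝ)
    (h : ∀ y, L (hermSq φ y ^ (r + k)) =
      W * designConst (Module.finrank ℝ F) d (r + k) * ‖y‖ ^ (2 * (r + k))) (y : FVec F d) :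
    L (hermSq φ y ^ r * normSqMap φ ^ k) =
      W * designConst (Module.finrank ℝ F) d r * ‖y‖ ^ (2 * r) := by
  have hm : 0 < Module.finrank ℝ F := Module.finrank_pos
  induction k generalizing L with
  | zero => simpa using h y
  | succ k ih =>
    have h1 := functional_hermSq_pow φ L _ (r + k) h
    -- The factor `‖φ‖²` produced by one Laplacian is absorbed into the functional.
    have h2 := ih (L.comp (LinearMap.mulRight ℝ (normSqMap φ))) fun y => by
      have h3 := h1 y
      rw [← add_assoc, designConst_succ] at h3
      have h4 : (Module.finrank ℝ F + 2 * (r + k : ℕ) : ℝ) ≠ 0 := by positivity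
      have h5 : (Module.finrank ℝ F * d + 2 * (r + k : ℕ) : ℝ) ≠ 0 := by positivity
      refine mul_left_cancel₀ h4 ?_
      simp only [LinearMap.comp_apply, LinearMap.mulRight_apply]
      rw [h3]
      field_simp
    simpa [pow_succ, mul_assoc] using h2

end Laplacian

/-! ### Invariance of the surface measure. -/

section SurfaceMeasure

variable {E : Type} [NormedAddCommGroup E] [InnerProductSpace ℝ E] [FiniteDimensional ℝ E]
  [MeasurableSpace E] [BorelSpace E]

instance [Nontrivial E] : IsProbabilityMeasure (surfaceMeasure E) := by
  refine ⟨?_⟩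
  rw [surfaceMeasure, Measure.smul_apply, smul_eq_mul]
  refine ENNReal.inv_mul_cancel ?_ (measure_ne_top _ _)
  rw [Ne, Measure.measure_univ_eq_zero]
  exact Measure.toSphere_ne_zero _

/-- A linear isometry acts on the unit sphere. -/
def sphereMap (T : E ≃ₗᵢ[ℝ] E) (x : Metric.sphere (0 : E) 1) : Metric.sphere (0 : E) 1 :=
  ⟨T x, by simp⟩

-- The spherical measure of `s` is a multiple of the volume of the cone over `s`, and isometries map
-- cones to cones and preserve volume.
open Pointwise in
theorem measurePreserving_sphereMap (T : E ≃ₗᵢ[ℝ] E) :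
    MeasurePreserving (sphereMap T) (surfaceMeasure E) (surfaceMeasure E) := by
  have hm : Measurable (sphereMap T) :=
    (T.continuous.measurable.comp measurable_subtype_coe).subtype_mk
  refine MeasurePreserving.smul_measure ⟨hm, ?_⟩ _
  ext s hs
  rw [Measure.map_apply hm hs, Measure.toSphere_apply' _ (hm hs), Measure.toSphere_apply' _ hs]
  congr 1
  have h : Set.Ioo (0 : ℝ) 1 • ((↑) '' (sphereMap T ⁻¹' s) : Set E) =
      T ⁻¹' (Set.Ioo (0 : ℝ) 1 • ((↑) '' s)) := by
    ext x
    simp only [Set.mem_smul, Set.mem_preimage, Set.mem_image]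
    constructor
    · rintro ⟨r, hr, _, ⟨y, hy, rfl⟩, rfl⟩
      exact ⟨r, hr, _, ⟨_, hy, rfl⟩, by simp [sphereMap]⟩
    · rintro ⟨r, hr, _, ⟨y, hy, rfl⟩, h⟩
      refine ⟨r, hr, _, ⟨sphereMap T.symm y, ?_, rfl⟩, ?_⟩
      · have : sphereMap T (sphereMap T.symm y) = y := by ext; simp [sphereMap]
        rwa [this]
      · apply T.injective
        simp [sphereMap, h]
  rw [h]
  exact MeasurePreserving.measure_preimage_equiv (f := T.toHomeomorph.toMeasurableEquiv)
    (LinearIsometryEquiv.measurePreserving T) _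

theorem integral_comp_isometry (T : E ≃ₗᵢ[ℝ] E) (f : E → ℝ) :
    ∫ x : Metric.sphere (0 : E) 1, f (T x) ∂surfaceMeasure E =
      ∫ x : Metric.sphere (0 : E) 1, f x ∂surfaceMeasure E := by
  have he : MeasurableEmbedding (sphereMap T) := by
    refine Continuous.measurableEmbedding ?_ fun x y h => ?_
    · exact (T.continuous.comp continuous_subtype_val).subtype_mk _
    · exact Subtype.ext (T.injective (congrArg Subtype.val h))
  exact (measurePreserving_sphereMap T).integral_comp he (fun x => f x)

instance : IsFiniteMeasure (surfaceMeasure E) := by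
  cases subsingleton_or_nontrivial E
  · have : (volume : Measure E).toSphere = 0 := by
      rw [Measure.toSphere_eq_zero_iff]; assumption
    rw [surfaceMeasure, this, smul_zero]
    infer_instance
  · infer_instance

theorem integrable_of_continuous_sphere {f : Metric.sphere (0 : E) 1 → ℝ} (hf : Continuous f) :
    Integrable f (surfaceMeasure E) :=
  hf.integrable_of_hasCompactSupport (HasCompactSupport.of_compactSpace f)

/-- Integration over the unit sphere, as a linear functional on continuous functions. -/
def sphereIntegral (E : Type) [NormedAddCommGroup E] [InnerProductSpace ℝ E]
    [FiniteDimensional ℝ E] [MeasurableSpace E] [BorelSpace E] :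
    C(Metric.sphere (0 : E) 1, ℝ) →ₗ[ℝ] ℝ where
  toFun f := ∫ x, f x ∂surfaceMeasure E
  map_add' f g := integral_add (integrable_of_continuous_sphere f.continuous)
    (integrable_of_continuous_sphere g.continuous)
  map_smul' r _ := integral_const_mul r _

end SurfaceMeasure

/-! ### The moments of the sphere. -/

section Moments

variable {F : Type} [NormedDivisionRing F] [StarRing F] [InnerProductSpace ℝ F]
  [EuclideanDivisionRing F] [FiniteDimensional ℝ F] {d : ℕ}

/-- The inclusion of the unit sphere. -/
def sphereIncl (F : Type) [NormedDivisionRing F] (d : ℕ) :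
    C(Metric.sphere (0 : FVec F d) 1, FVec F d) := ⟨Subtype.val, continuous_subtype_val⟩

theorem nontrivial_FVec (F : Type) [NormedDivisionRing F] {d : ℕ} (hd : 1 ≤ d) :
    Nontrivial (FVec F d) :=
  have : Nonempty (Fin d) := ⟨⟨0, hd⟩⟩
  (WithLp.equiv 2 (Fin d → F)).nontrivial

/-- Unitary maps act transitively on the unit sphere, and the map taking `a` to `b` can be chosen
so that it fixes the orthogonal complement of `{a, b}`. -/
theorem exists_unitaryEquiv (a b : FVec F d) (ha : ‖a‖ = 1) (hb : ‖b‖ = 1) :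
    ∃ T : FVec F d ≃ₗᵢ[ℝ] FVec F d, (∀ x y, herm (T x) (T y) = herm x y) ∧
      (∀ (c : F) x, T (MulOpposite.op c • x) = MulOpposite.op c • T x) ∧ T a = b ∧
      ∀ x, herm a x = 0 → herm b x = 0 → T x = x := by
  obtain ⟨T, h1, h2, h3, h4⟩ := exists_unitary a b ha hb
  have hn : ∀ x, ‖T x‖ = ‖x‖ := fun x => by
    have h := h1 x x
    rw [herm_self, herm_self] at h
    have h5 := smul_left_injective ℝ (one_ne_zero (α := F)) h
    exact (pow_left_inj₀ (norm_nonneg _) (norm_nonneg _) two_ne_zero).1 h5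
  exact ⟨LinearIsometry.toLinearIsometryEquiv ⟨T, hn⟩ rfl, h1, h2, h3, h4⟩

variable [MeasurableSpace (FVec F d)] [BorelSpace (FVec F d)]

/-- Unitary transitivity makes the integral constant on unit vectors; homogeneity does the rest. -/
theorem exists_integral_norm_herm_pow (hd : 1 ≤ d) (t : ℕ) : ∃ M : ℝ, ∀ y : FVec F d,
    ∫ x : Metric.sphere (0 : FVec F d) 1, ‖herm (x : FVec F d) y‖ ^ (2 * t)
      ∂surfaceMeasure (FVec F d) = M * ‖y‖ ^ (2 * t) := by
  have := nontrivial_FVec F hd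
  obtain ⟨a, ha⟩ := exists_norm_eq (FVec F d) zero_le_one
  have h : ∀ b : FVec F d, ‖b‖ = 1 →
      ∫ x : Metric.sphere (0 : FVec F d) 1, ‖herm (x : FVec F d) b‖ ^ (2 * t)
        ∂surfaceMeasure (FVec F d) =
      ∫ x : Metric.sphere (0 : FVec F d) 1, ‖herm (x : FVec F d) a‖ ^ (2 * t)
        ∂surfaceMeasure (FVec F d) := by
    intro b hb
    obtain ⟨T, h1, -, h3, -⟩ := exists_unitaryEquiv a b ha hb
    rw [← integral_comp_isometry T fun x => ‖herm x b‖ ^ (2 * t), ← h3]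
    simp only [h1]
  refine ⟨∫ x : Metric.sphere (0 : FVec F d) 1, ‖herm (x : FVec F d) a‖ ^ (2 * t)
    ∂surfaceMeasure (FVec F d), fun y => ?_⟩
  by_cases hy : y = 0
  · subst hy
    have h0 : ∀ x : FVec F d, herm x 0 = 0 := fun x => by simp [herm]
    rcases eq_or_ne t 0 with rfl | ht
    · simp
    · simp [h0, ht]
  · have hy' : ‖y‖ ≠ 0 := norm_ne_zero_iff.2 hy
    rw [← h (‖y‖⁻¹ • y) (by rw [norm_smul]; simp [hy']), ← integral_mul_const]
    congr 1
    ext x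
    rw [herm_smul_right, norm_smul, norm_inv, norm_norm, mul_comm ‖y‖⁻¹, ← mul_pow,
      inv_mul_cancel_right₀ hy']

theorem integral_norm_herm_pow (hd : 1 ≤ d) (t : ℕ) (y : FVec F d) :
    ∫ x : Metric.sphere (0 : FVec F d) 1, ‖herm (x : FVec F d) y‖ ^ (2 * t)
      ∂surfaceMeasure (FVec F d) = designConst (Module.finrank ℝ F) d t * ‖y‖ ^ (2 * t) := by
  have := nontrivial_FVec F hd
  induction t generalizing y with
  | zero => simp [designConst]
  | succ t ih =>
    obtain ⟨M, hM⟩ := exists_integral_norm_herm_pow (F := F) hd (t + 1)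
    -- On the sphere `‖x‖² = 1`, so the Laplacian relates `M` directly to the moment of order `t`.
    have h1 := functional_hermSq_pow (sphereIncl F d) (sphereIntegral (FVec F d)) M t fun y => by
      rw [← hM]
      simp [sphereIntegral, hermSq, sphereIncl, pow_mul]
    have h2 : ∀ y, sphereIntegral (FVec F d) (hermSq (sphereIncl F d) y ^ t *
        normSqMap (sphereIncl F d)) = designConst (Module.finrank ℝ F) d t * ‖y‖ ^ (2 * t) :=
      fun y => by
        rw [← ih]
        simp [sphereIntegral, hermSq, sphereIncl, normSqMap, pow_mul]
    obtain ⟨a, ha⟩ := exists_norm_eq (FVec F d) zero_le_one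
    have h3 := h1 a
    rw [h2, ha] at h3
    have hm : 0 < Module.finrank ℝ F := Module.finrank_pos
    rw [hM, designConst_succ]
    congr 1
    have h5 : (Module.finrank ℝ F * d + 2 * t : ℝ) ≠ 0 := by positivity
    field_simp
    linear_combination -h3

end Moments

/-! ### Equality in the variational inequality. -/

section Design

variable {F : Type} [NormedDivisionRing F] [StarRing F] [InnerProductSpace ℝ F]
  [EuclideanDivisionRing F] [FiniteDimensional ℝ F] {d : ℕ}

/-- `|⟨x, y⟩|²` is the real Hilbert–Schmidt inner product of the matrices `x x*` and `y y*`, written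
in coordinates. -/
theorem norm_herm_sq_eq_sum (x y : FVec F d) :
    ‖herm x y‖ ^ 2 = ∑ p : Fin d × Fin d × Fin (Module.finrank ℝ F),
      inner ℝ (x p.1 * star (x p.2.1)) (stdOrthonormalBasis ℝ F p.2.2) *
        inner ℝ (y p.1 * star (y p.2.1)) (stdOrthonormalBasis ℝ F p.2.2) := by
  simp only [Fintype.sum_prod_type]
  have h : ∀ p q : F, ∑ k, inner ℝ p (stdOrthonormalBasis ℝ F k) *
      inner ℝ q (stdOrthonormalBasis ℝ F k) = inner ℝ p q := fun p q => by
    rw [← (stdOrthonormalBasis ℝ F).sum_inner_mul_inner p q]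
    simp only [real_inner_comm]
  simp only [h]
  rw [← real_inner_self_eq_norm_sq]
  simp only [herm, sum_inner, inner_sum]
  rw [Finset.sum_comm]
  refine Finset.sum_congr rfl fun i _ => Finset.sum_congr rfl fun j _ => ?_
  rw [EuclideanDivisionRing.inner_mul_left_eq, star_star, real_inner_comm, ← mul_assoc,
    EuclideanDivisionRing.inner_mul_right_eq]

/-- The kernel `|⟨x, y⟩|^{2t}` has a finite-dimensional feature map. -/
theorem exists_feature_map (F : Type) [NormedDivisionRing F] [StarRing F] [InnerProductSpace ℝ F]
    [EuclideanDivisionRing F] [FiniteDimensional ℝ F] (d t : ℕ) :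
    ∃ (A : Type) (_ : Fintype A) (φ : A → FVec F d → ℝ), (∀ a, Continuous (φ a)) ∧
      ∀ x y, ‖herm x y‖ ^ (2 * t) = ∑ a, φ a x * φ a y := by
  -- The features are the coordinates of the `t`-th tensor power of `x x*`.
  refine ⟨Fin t → Fin d × Fin d × Fin (Module.finrank ℝ F), inferInstance,
    fun p x => ∏ s, inner ℝ (x (p s).1 * star (x (p s).2.1))
      (stdOrthonormalBasis ℝ F (p s).2.2), fun p => by fun_prop, fun x y => ?_⟩
  rw [pow_mul, norm_herm_sq_eq_sum, Finset.sum_pow', Fintype.piFinset_univ]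
  simp only [Finset.prod_mul_distrib]

variable [MeasurableSpace (FVec F d)] [BorelSpace (FVec F d)]

/-- In feature space, `|∑ wⱼ φ(vⱼ) - W ∫ φ|² = c W² - 2 c W² + c W² = 0`. Pairing the resulting
equality of vectors with `φ(y)` gives the claim. -/
theorem sum_norm_herm_pow_of_design (hd : 1 ≤ d) (t : ℕ) {ι : Type} [Fintype ι] (w : ι → ℝ)
    (v : ι → FVec F d)
    (h : ∑ j, ∑ k, w j * w k * ‖herm (v j) (v k)‖ ^ (2 * t) =
      designConst (Module.finrank ℝ F) d t * (∑ l, w l * ‖v l‖ ^ (2 * t)) ^ 2) (y : FVec F d) :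
    ∑ j, w j * ‖herm (v j) y‖ ^ (2 * t) = (∑ l, w l * ‖v l‖ ^ (2 * t)) *
      designConst (Module.finrank ℝ F) d t * ‖y‖ ^ (2 * t) := by
  have := nontrivial_FVec F hd
  obtain ⟨A, _, φ, hφ, hK⟩ := exists_feature_map F d t
  set W := ∑ l, w l * ‖v l‖ ^ (2 * t) with hW
  set c := designConst (Module.finrank ℝ F) d t
  set σ := surfaceMeasure (FVec F d)
  let Φ : A → ℝ := fun a => ∫ x : Metric.sphere (0 : FVec F d) 1, φ a x ∂σ
  have hint : ∀ a, Integrable (fun x : Metric.sphere (0 : FVec F d) 1 => φ a x) σ := fun a =>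
    integrable_of_continuous_sphere ((hφ a).comp continuous_subtype_val)
  have h1 : ∀ z, ∑ a, Φ a * φ a z = c * ‖z‖ ^ (2 * t) := fun z => by
    rw [← integral_norm_herm_pow hd t z]
    simp only [hK]
    rw [integral_finsetSum _ fun a _ => (hint a).mul_const _]
    simp only [integral_mul_const, Φ, σ]
  have h2 : ∑ a, Φ a * Φ a = c := by
    have h3 : ∑ a, Φ a * Φ a = ∫ x : Metric.sphere (0 : FVec F d) 1, ∑ a, Φ a * φ a x ∂σ := by
      rw [integral_finsetSum _ fun a _ => (hint a).const_mul _]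
      simp only [integral_const_mul, Φ]
    rw [h3]
    simp [h1, σ]
  have h4 : ∑ a, (∑ j, w j * φ a (v j) - W * Φ a) ^ 2 = 0 := by
    have h5 : ∑ a, (∑ j, w j * φ a (v j)) ^ 2 = c * W ^ 2 := by
      rw [← h]
      simp_rw [hK, pow_two, Finset.sum_mul_sum, Finset.mul_sum]
      rw [Finset.sum_comm]
      refine Finset.sum_congr rfl fun j _ => ?_
      rw [Finset.sum_comm]
      refine Finset.sum_congr rfl fun k _ => Finset.sum_congr rfl fun a _ => ?_
      ring
    have h6 : ∑ a, (∑ j, w j * φ a (v j)) * Φ a = c * W := by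
      simp only [Finset.sum_mul]
      rw [Finset.sum_comm, hW, Finset.mul_sum]
      refine Finset.sum_congr rfl fun j _ => ?_
      have := h1 (v j)
      rw [mul_left_comm, ← this, Finset.mul_sum]
      refine Finset.sum_congr rfl fun a _ => ?_
      ring
    have h7 : ∀ a, (∑ j, w j * φ a (v j) - W * Φ a) ^ 2 = (∑ j, w j * φ a (v j)) ^ 2 -
        2 * W * ((∑ j, w j * φ a (v j)) * Φ a) + W ^ 2 * (Φ a * Φ a) := fun a => by ring
    simp only [h7, Finset.sum_add_distrib, Finset.sum_sub_distrib, ← Finset.mul_sum, h5, h6, h2]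
    ring
  have h8 : ∀ a, ∑ j, w j * φ a (v j) = W * Φ a := fun a => by
    have := (Finset.sum_eq_zero_iff_of_nonneg fun a _ => sq_nonneg _).1 h4 a (Finset.mem_univ a)
    exact sub_eq_zero.1 (pow_eq_zero_iff two_ne_zero |>.1 this)
  simp only [hK, Finset.mul_sum]
  rw [Finset.sum_comm, mul_assoc, ← h1, Finset.mul_sum]
  refine Finset.sum_congr rfl fun a _ => ?_
  rw [← mul_assoc, ← h8, Finset.sum_mul]
  simp only [mul_assoc]

/-- A spherical `(t,t)`-design is, after reweighting, a spherical `(r,r)`-design for `r ≤ t`. -/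
theorem design_sum_of_le (hd : 1 ≤ d) {r t : ℕ} (hrt : r ≤ t) {ι : Type} [Fintype ι] (w : ι → ℝ)
    (v : ι → FVec F d)
    (h : ∑ j, ∑ k, w j * w k * ‖herm (v j) (v k)‖ ^ (2 * t) =
      designConst (Module.finrank ℝ F) d t * (∑ l, w l * ‖v l‖ ^ (2 * t)) ^ 2) :
    ∑ j, ∑ k, (w j * ‖v j‖ ^ (2 * (t - r))) * (w k * ‖v k‖ ^ (2 * (t - r))) *
      ‖herm (v j) (v k)‖ ^ (2 * r) =
      designConst (Module.finrank ℝ F) d r * (∑ l, w l * ‖v l‖ ^ (2 * t)) ^ 2 := by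
  obtain ⟨k, rfl⟩ := Nat.exists_eq_add_of_le hrt
  -- With the discrete topology the finite family is a continuous map and the weighted sum a
  -- functional `L` as above.
  let : TopologicalSpace ι := ⊥
  have : DiscreteTopology ι := ⟨rfl⟩
  let φ : C(ι, FVec F d) := ⟨v, continuous_of_discreteTopology⟩
  let L : C(ι, ℝ) →ₗ[ℝ] ℝ :=
    { toFun f := ∑ j, w j * f j
      map_add' f g := by simp [mul_add, Finset.sum_add_distrib]
      map_smul' r f := by simp [Finset.mul_sum, mul_left_comm] }
  have h1 := functional_hermSq_descent hd φ (∑ l, w l * ‖v l‖ ^ (2 * (r + k))) r k L fun y => by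
    rw [← sum_norm_herm_pow_of_design hd _ w v h]
    simp [L, hermSq, φ, pow_mul]
  have h2 : ∀ y : FVec F d, ∑ j, w j * ‖v j‖ ^ (2 * k) * ‖herm (v j) y‖ ^ (2 * r) =
      (∑ l, w l * ‖v l‖ ^ (2 * (r + k))) * designConst (Module.finrank ℝ F) d r *
        ‖y‖ ^ (2 * r) := fun y => by
    rw [← h1 y]
    refine Finset.sum_congr rfl fun j _ => ?_
    simp only [hermSq, normSqMap, φ, pow_mul, ContinuousMap.mul_apply, ContinuousMap.pow_apply,
      ContinuousMap.coe_mk]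
    ring
  rw [add_tsub_cancel_left, Finset.sum_comm, pow_two]
  -- The identity `h2` in `y` is now taken at `y = vⱼ` and summed against the modified weights.
  calc _ = ∑ j, (w j * ‖v j‖ ^ (2 * k)) *
        ∑ i, w i * ‖v i‖ ^ (2 * k) * ‖herm (v i) (v j)‖ ^ (2 * r) := by
        refine Finset.sum_congr rfl fun j _ => ?_
        rw [Finset.mul_sum]
        refine Finset.sum_congr rfl fun i _ => ?_
        ring
    _ = _ := by
        simp only [h2]
        rw [← mul_assoc, mul_comm _ (∑ l, w l * ‖v l‖ ^ (2 * (r + k))), ← mul_assoc, Finset.mul_sum]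
        refine Finset.sum_congr rfl fun j _ => ?_
        ring

end Design

/-! ### Two-point integrals as polynomials in `|⟨a, b⟩|²`. -/

section TwoPointMoments

open Polynomial

/-- The sum is even in `rs`, and `s² = 1 - r²`, `(rs)² = r²(1 - r²)`. The degree bound comes from
the recurrence `u^{k+2} + v^{k+2} = (u + v)(u^{k+1} + v^{k+1}) - uv(u^k + v^k)`, in which `u + v`
and `uv` have degrees at most 1 and 2 in `r²`. -/
theorem exists_even_part {R : Type*} [CommRing R] [Algebra ℝ R] (A B D : R) (k : ℕ) :
    ∃ p : R[X], p.natDegree ≤ k ∧ ∀ r s : ℝ, r ^ 2 + s ^ 2 = 1 →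
      2 * p.eval (algebraMap ℝ R (r ^ 2)) =
        (algebraMap ℝ R (r ^ 2) * A + algebraMap ℝ R (r * s) * B +
          algebraMap ℝ R (s ^ 2) * D) ^ k +
        (algebraMap ℝ R (r ^ 2) * A - algebraMap ℝ R (r * s) * B +
          algebraMap ℝ R (s ^ 2) * D) ^ k := by
  induction k using Nat.twoStepInduction with
  | zero => exact ⟨1, by simp, fun r s _ => by simp; norm_num⟩
  | one =>
    refine ⟨C A * X + C D * (1 - X), by compute_degree, fun r s h => ?_⟩
    have : algebraMap ℝ R (s ^ 2) = 1 - algebraMap ℝ R (r ^ 2) := by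
      rw [← map_one (algebraMap ℝ R), ← map_sub]; congr 1; linarith
    simp only [this, eval_add, eval_mul, eval_C, eval_X, eval_sub, eval_one]
    ring
  | more k ih0 ih1 =>
    obtain ⟨p0, hp0, h0⟩ := ih0
    obtain ⟨p1, hp1, h1⟩ := ih1
    refine ⟨2 * (C A * X + C D * (1 - X)) * p1 -
      ((C A * X + C D * (1 - X)) ^ 2 - C (B ^ 2) * X * (1 - X)) * p0, ?_, fun r s h => ?_⟩
    · have hP : (C A * X + C D * (1 - X)).natDegree ≤ 1 := by compute_degree
      have h2 : (2 * (C A * X + C D * (1 - X))).natDegree ≤ 1 := by compute_degree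
      have h3 : ((C A * X + C D * (1 - X)) ^ 2 - C (B ^ 2) * X * (1 - X)).natDegree ≤ 2 := by
        compute_degree
      refine (natDegree_sub_le _ _).trans (max_le ?_ ?_)
      · exact natDegree_mul_le.trans (by omega)
      · exact natDegree_mul_le.trans (by omega)
    · have hs : algebraMap ℝ R (s ^ 2) = 1 - algebraMap ℝ R (r ^ 2) := by
        rw [← map_one (algebraMap ℝ R), ← map_sub]; congr 1; linarith
      have hrs : algebraMap ℝ R (r * s) ^ 2 =
          algebraMap ℝ R (r ^ 2) * (1 - algebraMap ℝ R (r ^ 2)) := by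
        rw [← hs, ← map_pow, ← map_mul, mul_pow]
      have h0 := h0 r s h
      have h1 := h1 r s h
      rw [hs] at h0 h1 ⊢
      generalize algebraMap ℝ R (r ^ 2) = ρ at *
      generalize algebraMap ℝ R (r * s) = q at *
      simp only [eval_add, eval_mul, eval_C, eval_X, eval_sub, eval_one, eval_pow, eval_ofNat]
      have e : 2 * (2 * (A * ρ + D * (1 - ρ)) * eval ρ p1 -
          ((A * ρ + D * (1 - ρ)) ^ 2 - B ^ 2 * ρ * (1 - ρ)) * eval ρ p0) =
          2 * (A * ρ + D * (1 - ρ)) * (2 * eval ρ p1) -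
          ((A * ρ + D * (1 - ρ)) ^ 2 - B ^ 2 * q ^ 2) * (2 * eval ρ p0) := by
        rw [hrs]; ring
      rw [e, h0, h1]
      ring

variable {F : Type} [NormedDivisionRing F] [StarRing F] [InnerProductSpace ℝ F]
  [EuclideanDivisionRing F] {d : ℕ}

open MulOpposite (op)

/-- A unit vector is, up to a phase, the sum of a nonnegative multiple of a given unit vector `a`
and a vector orthogonal to `a`. -/
theorem exists_orthogonal_decomposition (a b : FVec F d) (ha : ‖a‖ = 1) (hb : ‖b‖ = 1) :
    ∃ (c : F) (u : FVec F d), ‖c‖ = 1 ∧ herm a u = 0 ∧ op c • b = ‖herm a b‖ • a + u ∧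
      ‖herm a b‖ ^ 2 + ‖u‖ ^ 2 = 1 := by
  obtain ⟨c, hc, hc2⟩ : ∃ c : F, ‖c‖ = 1 ∧ herm a b * c = ‖herm a b‖ • (1 : F) := by
    by_cases h : herm a b = 0
    · exact ⟨1, by simp, by simp [h]⟩
    · have h' : ‖herm a b‖ ≠ 0 := norm_ne_zero_iff.2 h
      exact ⟨‖herm a b‖ • (herm a b)⁻¹, by rw [norm_smul]; simp [h'], by
        rw [mul_smul_comm, mul_inv_cancel₀ h]⟩
  have h1 : herm a (op c • b - ‖herm a b‖ • a) = 0 := by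
    rw [herm_sub_right, herm_op_smul_right, hc2, herm_smul_right, herm_self, ha]
    simp
  refine ⟨c, op c • b - ‖herm a b‖ • a, hc, h1, by simp, ?_⟩
  have h2 : inner ℝ a (op c • b - ‖herm a b‖ • a) = 0 := by
    rw [← inner_one_herm, h1, inner_zero_right]
  have h3 := norm_add_sq_real (‖herm a b‖ • a) (op c • b - ‖herm a b‖ • a)
  rw [inner_smul_left, h2, add_sub_cancel, norm_op_smul, hc, hb, norm_smul, ha] at h3
  simp at h3
  exact h3.symm

variable [FiniteDimensional ℝ F] [MeasurableSpace (FVec F d)] [BorelSpace (FVec F d)]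

/-- By unitary and phase invariance the pair `(a, b)` may be replaced by `(e, r e + s e')` with `e,
e'` orthonormal and `r = |⟨a, b⟩|`. The value is unchanged under `s ↦ -s`, so only the even part in
`s` matters. The degree bound is independent of `h`, which later permits `min j k`. -/
theorem exists_twoPoint_moment (hd : 1 ≤ d) (h : ℝ[X]) (k : ℕ) :
    ∃ f : ℝ[X], f.natDegree ≤ k ∧ ∀ a b : FVec F d, ‖a‖ = 1 → ‖b‖ = 1 →
      ∫ x : Metric.sphere (0 : FVec F d) 1, h.eval (‖herm (x : FVec F d) a‖ ^ 2) *
        ‖herm (x : FVec F d) b‖ ^ (2 * k) ∂surfaceMeasure (FVec F d) =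
      f.eval (‖herm a b‖ ^ 2) := by
  have := nontrivial_FVec F hd
  set I : FVec F d → FVec F d → ℝ := fun a b =>
    ∫ x : Metric.sphere (0 : FVec F d) 1, h.eval (‖herm (x : FVec F d) a‖ ^ 2) *
        ‖herm (x : FVec F d) b‖ ^ (2 * k) ∂surfaceMeasure (FVec F d) with hI
  have hT : ∀ (T : FVec F d ≃ₗᵢ[ℝ] FVec F d), (∀ x y, herm (T x) (T y) = herm x y) →
      ∀ a b, I (T a) (T b) = I a b := fun T hT a b => by
    simp only [hI]
    rw [← integral_comp_isometry T fun x => h.eval (‖herm x (T a)‖ ^ 2) * ‖herm x (T b)‖ ^ (2 * k)]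
    simp only [hT]
  have hphase : ∀ (c : F), ‖c‖ = 1 → ∀ a b, I a (op c • b) = I a b := fun c hc a b => by
    simp only [hI, herm_op_smul_right, norm_mul, hc, mul_one]
  obtain ⟨e, he⟩ := exists_norm_eq (FVec F d) zero_le_one
  by_cases hex : ∃ e' : FVec F d, ‖e'‖ = 1 ∧ herm e e' = 0
  · obtain ⟨e', he', hee'⟩ := hex
    have hee'' : herm e' e = 0 := by rw [← star_herm, hee', star_zero]
    have key : ∀ (a u : FVec F d) (r : ℝ), ‖a‖ = 1 → herm a u = 0 →
        I a (r • a + u) = I e (r • e + ‖u‖ • e') := by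
      intro a u r ha hau
      obtain ⟨T, h1, -, h3, -⟩ := exists_unitaryEquiv a e ha he
      rw [← hT T h1, map_add, map_smul, h3]
      by_cases hu : u = 0
      · simp [hu]
      have hu' : ‖u‖ ≠ 0 := norm_ne_zero_iff.2 hu
      have hTu : herm e (T u) = 0 := by rw [← h3, h1, hau]
      -- `S` turns the second direction into `e'` and fixes `e`, which is orthogonal to both.
      obtain ⟨S, g1, -, g3, g4⟩ := exists_unitaryEquiv (‖u‖⁻¹ • T u) e'
        (by rw [norm_smul]; simp [hu']) he'
      have hSe : S e = e := g4 e (by rw [herm_smul_left, ← star_herm, hTu]; simp) hee''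
      have hSu : S (T u) = ‖u‖ • e' := by rw [← g3, map_smul, smul_inv_smul₀ hu']
      rw [← hT S g1, map_add, map_smul, hSe, hSu]
    obtain ⟨p, hp, hpe⟩ := exists_even_part (hermSq (sphereIncl F d) e)
      (hermPolar (sphereIncl F d) e e') (hermSq (sphereIncl F d) e') k
    let L := (sphereIntegral (FVec F d)).comp
      (LinearMap.mulLeft ℝ (aeval (hermSq (sphereIncl F d) e) h))
    have hL : ∀ r s : ℝ, I e (r • e + s • e') =
        L ((algebraMap ℝ _ (r ^ 2) * hermSq (sphereIncl F d) e +
          algebraMap ℝ _ (r * s) * hermPolar (sphereIncl F d) e e' +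
          algebraMap ℝ _ (s ^ 2) * hermSq (sphereIncl F d) e') ^ k) := by
      intro r s
      simp only [hI, L, LinearMap.comp_apply, LinearMap.mulLeft_apply, sphereIntegral,
        LinearMap.coe_mk, AddHom.coe_mk]
      congr 1
      ext x
      have h1 : (aeval (hermSq (sphereIncl F d) e) h) x = h.eval (‖herm (x : FVec F d) e‖ ^ 2) := by
        have h2 := aeval_algHom_apply (ContinuousMap.evalAlgHom ℝ ℝ x) (hermSq (sphereIncl F d) e) h
        simp only [ContinuousMap.evalAlgHom_apply] at h2
        rw [← h2, coe_aeval_eq_eval]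
        rfl
      rw [ContinuousMap.mul_apply, h1, pow_mul, herm_add_right, herm_smul_right, herm_smul_right,
        norm_add_sq_real, inner_smul_left, inner_smul_right, norm_smul, norm_smul]
      simp [hermSq, hermPolar, sphereIncl, mul_pow]
      left
      ring
    refine ⟨coeffMap L p, (natDegree_coeffMap_le L p).trans hp, fun a b ha hb => ?_⟩
    obtain ⟨c, u, hc, hau, hbu, hru⟩ := exists_orthogonal_decomposition a b ha hb
    have h1 : I a b = I e (‖herm a b‖ • e + ‖u‖ • e') := by
      rw [← hphase c hc, hbu, key a u _ ha hau]
    have h2 : I e (‖herm a b‖ • e + (-‖u‖) • e') = I e (‖herm a b‖ • e + ‖u‖ • e') := by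
      have h3 := key e ((-‖u‖) • e') ‖herm a b‖ he (by rw [herm_smul_right, hee', smul_zero])
      rw [h3, norm_smul, he']
      simp
    have h3 := congrArg L (hpe _ _ hru)
    rw [map_add, ← hL, two_mul, map_add, ← eval_coeffMap] at h3
    have h4 := hL ‖herm a b‖ (-‖u‖)
    rw [mul_neg, map_neg, neg_mul, ← sub_eq_add_neg, neg_sq] at h4
    rw [← h4, h2, ← h1] at h3
    change I a b = _
    linarith
  -- Without a unit vector orthogonal to `e` there is only one line, and the integral is constant.
  · refine ⟨C (I e e), by simp, fun a b ha hb => ?_⟩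
    rw [eval_C]
    change I a b = I e e
    obtain ⟨c, u, hc, hau, hbu, hru⟩ := exists_orthogonal_decomposition a b ha hb
    obtain ⟨T, h1, -, h3, -⟩ := exists_unitaryEquiv a e ha he
    have hu : u = 0 := by
      by_contra hu
      have hu' : ‖u‖ ≠ 0 := norm_ne_zero_iff.2 hu
      refine hex ⟨‖u‖⁻¹ • T u, by rw [norm_smul]; simp [hu'], ?_⟩
      rw [herm_smul_right, ← h3, h1, hau, smul_zero]
    have hr : ‖herm a b‖ = 1 := by
      rw [hu] at hru
      nlinarith [norm_nonneg (herm a b), norm_zero (E := FVec F d)]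
    rw [← hphase c hc, hbu, hu, hr, one_smul, add_zero, ← hT T h1, h3]

theorem exists_twoPoint_moment_polynomial (hd : 1 ≤ d) (h g : ℝ[X]) :
    ∃ f : ℝ[X], f.natDegree ≤ g.natDegree ∧ ∀ a b : FVec F d, ‖a‖ = 1 → ‖b‖ = 1 →
      ∫ x : Metric.sphere (0 : FVec F d) 1, h.eval (‖herm (x : FVec F d) a‖ ^ 2) *
        g.eval (‖herm (x : FVec F d) b‖ ^ 2) ∂surfaceMeasure (FVec F d) =
      f.eval (‖herm a b‖ ^ 2) := by
  choose f hf hfe using fun k => exists_twoPoint_moment (F := F) hd h k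
  refine ⟨∑ k ∈ Finset.range (g.natDegree + 1), C (g.coeff k) * f k, ?_, fun a b ha hb => ?_⟩
  · refine natDegree_sum_le_of_forall_le _ _ fun k hk => (natDegree_C_mul_le _ _).trans
      ((hf k).trans ?_)
    rw [Finset.mem_range] at hk
    omega
  · have hc : ∀ y : FVec F d, Continuous fun x : Metric.sphere (0 : FVec F d) 1 =>
        ‖herm (x : FVec F d) y‖ ^ 2 := fun y => (hermSq (sphereIncl F d) y).continuous
    rw [eval_finsetSum]
    simp only [eval_eq_sum_range (p := g), Finset.mul_sum, eval_mul, eval_C]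
    rw [integral_finsetSum]
    · refine Finset.sum_congr rfl fun k _ => ?_
      rw [← hfe k a b ha hb, ← integral_const_mul]
      congr 1
      ext x
      rw [pow_mul]
      ring
    · intro k _
      exact integrable_of_continuous_sphere (((h.continuous.comp (hc a)).mul
        (((hc b).pow k).const_mul _)))

end TwoPointMoments

/-! ### Projective space as a Delsarte space. -/

section ProjectiveSpace

theorem measurable_FProj {F : Type} [NormedDivisionRing F] {d : ℕ} [MeasurableSpace (FVec F d)]
    {f : FProj F d → ℝ} (hf : Measurable fun x => f (lineOfSphere F d x)) : Measurable f := hf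

theorem measurable_lineOfSphere {F : Type} [NormedDivisionRing F] {d : ℕ}
    [MeasurableSpace (FVec F d)] : Measurable (lineOfSphere F d) := fun _ h => h

variable {F : Type} [NormedDivisionRing F] [StarRing F] [InnerProductSpace ℝ F]
  [EuclideanDivisionRing F] {d : ℕ}

open MulOpposite (op)

theorem lineOfSphere_surjective (p : FProj F d) : ∃ x, lineOfSphere F d x = p := by
  induction p using Projectivization.ind with
  | h v hv =>
    have hv' : ‖v‖ ≠ 0 := norm_ne_zero_iff.2 hv
    have h1 : ‖‖v‖⁻¹ • v‖ = 1 := by rw [norm_smul]; simp [hv']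
    refine ⟨⟨‖v‖⁻¹ • v, by simpa using h1⟩, ?_⟩
    refine (Projectivization.mk_eq_mk_iff' _ _ _ _ _).2 ⟨op (‖v‖⁻¹ • 1), ?_⟩
    ext i
    simp

theorem cosSq_lineOfSphere (x y : Metric.sphere (0 : FVec F d) 1) :
    cosSq (lineOfSphere F d x) (lineOfSphere F d y) =
      ‖herm (x : FVec F d) (y : FVec F d)‖ ^ 2 := by
  rw [lineOfSphere, lineOfSphere, cosSq_line, norm_eq_of_mem_sphere, norm_eq_of_mem_sphere]
  simp

theorem lineDist_lineOfSphere_sq (x y : Metric.sphere (0 : FVec F d) 1) :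
    lineDist (lineOfSphere F d x) (lineOfSphere F d y) ^ 2 =
      1 - ‖herm (x : FVec F d) (y : FVec F d)‖ ^ 2 := by
  rw [lineDist, Real.sq_sqrt, cosSq_lineOfSphere]
  rw [cosSq_lineOfSphere]
  have := norm_herm_le (x : FVec F d) (y : FVec F d)
  rw [norm_eq_of_mem_sphere, norm_eq_of_mem_sphere] at this
  nlinarith [norm_nonneg (herm (x : FVec F d) (y : FVec F d))]

omit [InnerProductSpace ℝ F] [EuclideanDivisionRing F] in
theorem lineDist_nonneg (p q : FProj F d) : 0 ≤ lineDist p q := Real.sqrt_nonneg _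

theorem one_sub_lineDist_sq (p q : FProj F d) : 1 - lineDist p q ^ 2 = cosSq p q := by
  obtain ⟨x, rfl⟩ := lineOfSphere_surjective p
  obtain ⟨y, rfl⟩ := lineOfSphere_surjective q
  rw [lineDist_lineOfSphere_sq, cosSq_lineOfSphere]
  ring

/-- The distance of two lines is the distance of a unit vector in one of them from the other. -/
theorem lineDist_lineOfSphere_le (x y : Metric.sphere (0 : FVec F d) 1) (a : F) :
    lineDist (lineOfSphere F d x) (lineOfSphere F d y) ≤
      ‖(y : FVec F d) - op a • (x : FVec F d)‖ := by
  refine (pow_le_pow_iff_left₀ (lineDist_nonneg _ _) (norm_nonneg _) two_ne_zero).1 ?_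
  rw [lineDist_lineOfSphere_sq, norm_sub_op_smul_sq _ _ (norm_eq_of_mem_sphere x),
    norm_eq_of_mem_sphere]
  nlinarith [sq_nonneg ‖herm (x : FVec F d) (y : FVec F d) - a‖]

theorem lineDist_lineOfSphere_eq (x y : Metric.sphere (0 : FVec F d) 1) :
    lineDist (lineOfSphere F d x) (lineOfSphere F d y) =
      ‖(y : FVec F d) - op (herm (x : FVec F d) (y : FVec F d)) • (x : FVec F d)‖ := by
  refine (pow_left_inj₀ (lineDist_nonneg _ _) (norm_nonneg _) two_ne_zero).1 ?_
  rw [lineDist_lineOfSphere_sq, norm_sub_op_smul_sq _ _ (norm_eq_of_mem_sphere x),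
    norm_eq_of_mem_sphere]
  simp

theorem lineDist_self (p : FProj F d) : lineDist p p = 0 := by
  obtain ⟨x, rfl⟩ := lineOfSphere_surjective p
  rw [lineDist_lineOfSphere_eq, herm_self, norm_eq_of_mem_sphere]
  simp

theorem lineDist_comm (p q : FProj F d) : lineDist p q = lineDist q p := by
  obtain ⟨x, rfl⟩ := lineOfSphere_surjective p
  obtain ⟨y, rfl⟩ := lineOfSphere_surjective q
  rw [lineDist, lineDist, cosSq_lineOfSphere, cosSq_lineOfSphere, norm_herm_comm]

theorem eq_of_lineDist_eq_zero (p q : FProj F d) (h : lineDist p q = 0) : p = q := by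
  obtain ⟨x, rfl⟩ := lineOfSphere_surjective p
  obtain ⟨y, rfl⟩ := lineOfSphere_surjective q
  rw [lineDist_lineOfSphere_eq, norm_eq_zero, sub_eq_zero] at h
  exact ((Projectivization.mk_eq_mk_iff' _ _ _ _ _).2 ⟨_, h.symm⟩).symm

/-- Project `z` to `y c` on the middle line, then to `x b c` on the first. The second leg is the
distance of `y` from its projection `x b`, scaled by `‖c‖ ≤ 1`. -/
theorem lineDist_triangle (p q r : FProj F d) :
    lineDist p r ≤ lineDist p q + lineDist q r := by
  obtain ⟨x, rfl⟩ := lineOfSphere_surjective p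
  obtain ⟨y, rfl⟩ := lineOfSphere_surjective q
  obtain ⟨z, rfl⟩ := lineOfSphere_surjective r
  set b := herm (x : FVec F d) (y : FVec F d)
  set c := herm (y : FVec F d) (z : FVec F d) with hc
  have hc1 : ‖c‖ ≤ 1 := by
    have := norm_herm_le (y : FVec F d) (z : FVec F d)
    rwa [norm_eq_of_mem_sphere, norm_eq_of_mem_sphere, one_mul] at this
  have h1 : (z : FVec F d) - op (b * c) • (x : FVec F d) =
      op c • ((y : FVec F d) - op b • (x : FVec F d)) +
        ((z : FVec F d) - op c • (y : FVec F d)) := by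
    rw [MulOpposite.op_mul, mul_smul, smul_sub]
    abel
  refine (lineDist_lineOfSphere_le x z (b * c)).trans ?_
  rw [h1, lineDist_lineOfSphere_eq, lineDist_lineOfSphere_eq]
  refine (norm_add_le _ _).trans (add_le_add_left ?_ _)
  rw [norm_op_smul]
  exact mul_le_of_le_one_left (norm_nonneg _) hc1

section Measure

theorem continuous_norm_herm_sq (y : FVec F d) :
    Continuous fun x : Metric.sphere (0 : FVec F d) 1 => ‖herm (x : FVec F d) y‖ ^ 2 := by
  have := (continuous_herm (F := F) (d := d)).comp
    (continuous_subtype_val (p := (· ∈ Metric.sphere (0 : FVec F d) 1)) |>.prodMk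
      (continuous_const (y := y)))
  exact (continuous_norm.comp this).pow 2

variable [MeasurableSpace (FVec F d)] [BorelSpace (FVec F d)]

theorem measurable_cosSq (p : FProj F d) : Measurable (cosSq p) := by
  obtain ⟨x, rfl⟩ := lineOfSphere_surjective p
  refine measurable_FProj ?_
  simp only [cosSq_lineOfSphere, norm_herm_comm (x : FVec F d)]
  exact (continuous_norm_herm_sq _).measurable

theorem measurable_lineDist (p : FProj F d) : Measurable (lineDist p) :=
  ((measurable_cosSq p).const_sub 1).sqrt

variable [FiniteDimensional ℝ F]

omit [StarRing F] [EuclideanDivisionRing F] in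
theorem integral_projMeasure {f : FProj F d → ℝ} (hf : Measurable f) :
    ∫ p, f p ∂projMeasure F d = ∫ x, f (lineOfSphere F d x) ∂surfaceMeasure (FVec F d) :=
  integral_map measurable_lineOfSphere.aemeasurable hf.aestronglyMeasurable

theorem exists_lineDist_moment (hd : 1 ≤ d) (j k : ℕ) :
    ∃ f : ℝ[X], f.natDegree ≤ k ∧ ∀ p q : FProj F d,
      ∫ x, lineDist p x ^ (2 * j) * lineDist q x ^ (2 * k) ∂projMeasure F d =
        f.eval (lineDist p q ^ 2) := by
  open Polynomial in
  have hdeg : ∀ k : ℕ, ((1 - X : ℝ[X]) ^ k).natDegree ≤ k := fun k => by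
    refine natDegree_pow_le.trans ?_
    have : (1 - X : ℝ[X]).natDegree ≤ 1 := by compute_degree
    nlinarith
  obtain ⟨f, hf, hfe⟩ := exists_twoPoint_moment_polynomial (F := F) hd
    ((1 - Polynomial.X) ^ j) ((1 - Polynomial.X) ^ k)
  refine ⟨f.comp (1 - Polynomial.X), ?_, fun p q => ?_⟩
  · refine Polynomial.natDegree_comp_le.trans ?_
    have h1 : (1 - Polynomial.X : ℝ[X]).natDegree ≤ 1 := by compute_degree
    have h2 := hf.trans (hdeg k)
    nlinarith
  · rw [integral_projMeasure
      (f := fun x => lineDist p x ^ (2 * j) * lineDist q x ^ (2 * k))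
      (((measurable_lineDist p).pow_const _).mul
      ((measurable_lineDist q).pow_const _))]
    obtain ⟨a, rfl⟩ := lineOfSphere_surjective p
    obtain ⟨b, rfl⟩ := lineOfSphere_surjective q
    have h : f.eval (‖herm (a : FVec F d) (b : FVec F d)‖ ^ 2) =
        (f.comp (1 - Polynomial.X)).eval
          (lineDist (lineOfSphere F d a) (lineOfSphere F d b) ^ 2) := by
      simp [lineDist_lineOfSphere_sq]
    rw [← h, ← hfe a b (norm_eq_of_mem_sphere a) (norm_eq_of_mem_sphere b)]
    congr 1
    ext x
    rw [pow_mul, pow_mul, lineDist_lineOfSphere_sq, lineDist_lineOfSphere_sq,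
      norm_herm_comm (a : FVec F d), norm_herm_comm (b : FVec F d)]
    simp

theorem isDelsarteSpace_FProj (hd : 1 ≤ d) :
    IsDelsarteSpace (lineDist (F := F) (d := d)) (projMeasure F d) where
  self := lineDist_self
  eq_of_zero := eq_of_lineDist_eq_zero
  symm := lineDist_comm
  triangle := lineDist_triangle
  bounded := ⟨1, fun p q => Real.sqrt_le_one.2 <| by
    have : 0 ≤ cosSq p q := by unfold cosSq; positivity
    linarith⟩
  measurable := measurable_lineDist
  finite := by unfold projMeasure; infer_instance
  moments j k := by
    -- The degree is bounded by the exponent of either factor; the smaller one is used.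
    rcases le_total j k with h | h
    · obtain ⟨f, hf, hfe⟩ := exists_lineDist_moment (F := F) hd k j
      refine ⟨f, by rwa [min_eq_left h], fun p q => ?_⟩
      rw [lineDist_comm p q, ← hfe]
      simp only [mul_comm]
    · obtain ⟨f, hf, hfe⟩ := exists_lineDist_moment (F := F) hd j k
      exact ⟨f, by rwa [min_eq_right h], hfe⟩

end Measure

end ProjectiveSpace

/-! ### Jacobi and Hoggar polynomials from the moments `c_t`. -/

section Jacobi

open Polynomial

/-- The linear functional on polynomials with moments `c`. -/
def momentFunctional (c : ℕ → ℝ) : ℝ[X] →ₗ[ℝ] ℝ :=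
  Polynomial.lsum fun i => c i • LinearMap.id

theorem momentFunctional_C_mul_X_pow (c : ℕ → ℝ) (a : ℝ) (n : ℕ) :
    momentFunctional c (C a * X ^ n) = a * c n := by
  rw [momentFunctional, lsum_apply, C_mul_X_pow_eq_monomial, sum_monomial_index]
  swap
  · simp
  simp [mul_comm]

theorem momentFunctional_X_pow (c : ℕ → ℝ) (n : ℕ) : momentFunctional c (X ^ n) = c n := by
  simpa using momentFunctional_C_mul_X_pow c 1 n

theorem momentFunctional_eq_sum (c : ℕ → ℝ) (g : ℝ[X]) :
    momentFunctional c g = ∑ i ∈ Finset.range (g.natDegree + 1), g.coeff i * c i := by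
  conv_lhs => rw [g.as_sum_range_C_mul_X_pow]
  simp only [map_sum, momentFunctional_C_mul_X_pow]

theorem ascPochhammer_eval_add (a : ℝ) (j n : ℕ) : (ascPochhammer ℝ (j + n)).eval a =
    (ascPochhammer ℝ j).eval a * (ascPochhammer ℝ n).eval (a + j) := by
  rw [← ascPochhammer_mul]
  simp

theorem designConst_eq {m d : ℕ} (hm : 0 < m) (hd : 1 ≤ d) (t : ℕ) : designConst m d t =
    (ascPochhammer ℝ t).eval ((m : ℝ) / 2) / (ascPochhammer ℝ t).eval ((m : ℝ) * d / 2) := by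
  induction t with
  | zero => simp [designConst]
  | succ t ih =>
    have h : (m * d + 2 * t : ℝ) ≠ 0 := by positivity
    have hB : 0 < (ascPochhammer ℝ t).eval ((m : ℝ) * d / 2) :=
      ascPochhammer_pos _ _ (by positivity)
    rw [designConst_succ, ih, ascPochhammer_succ_eval, ascPochhammer_succ_eval]
    have h2 : (m * d / 2 + t : ℝ) ≠ 0 := by positivity
    field_simp

/-- Up to sign the sum is a `k`-th finite difference at `0`. -/
theorem alternating_sum_choose_eval_eq_zero {q : ℝ[X]} {k : ℕ} (hq : q.natDegree < k) :
    ∑ j ∈ Finset.range (k + 1), (-1 : ℝ) ^ j * (k.choose j : ℝ) * q.eval (j : ℝ) = 0 := by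
  have h1 := congrFun (fwdDiff_iter_eq_zero_of_degree_lt hq) 0
  rw [fwdDiff_iter_eq_sum_shift] at h1
  have h2 : ∑ j ∈ Finset.range (k + 1), (-1 : ℝ) ^ j * (k.choose j : ℝ) * q.eval (j : ℝ) =
      (-1) ^ k * ∑ j ∈ Finset.range (k + 1), ((-1 : ℤ) ^ (k - j) * (k.choose j : ℤ)) •
        q.eval (0 + j • (1 : ℝ)) := by
    rw [Finset.mul_sum]
    refine Finset.sum_congr rfl fun j hj => ?_
    obtain ⟨i, rfl⟩ := Nat.exists_eq_add_of_le (Finset.mem_range_succ_iff.1 hj)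
    rw [add_tsub_cancel_left, zsmul_eq_mul, pow_add]
    push_cast
    have h3 : ((-1 : ℝ) ^ i) * (-1) ^ i = 1 := by rw [← mul_pow]; simp
    simp only [nsmul_eq_mul, mul_one, zero_add]
    linear_combination (-(-1) ^ j * ((j + i).choose j : ℝ) * q.eval (j : ℝ)) * h3
  rw [h2, h1]
  simp

/-- With `A = m/2`, `B = md/2` and `k = n + l + 1`, the `j`-th term carries `(A)_{n+j} / (A)_j = (A
+ j)_n` and `(B - 1 + k)_j / (B)_{n+j} = (B + n + j)_l / (B)_{n+l}`. Their product is a polynomial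
in `j` of degree at most `n + l < k`, annihilated by the `k`-th difference. -/
theorem momentFunctional_X_pow_mul_jacobiPoly {m d : ℕ} (hm : 0 < m) (hd : 1 ≤ d) {n k : ℕ}
    (hnk : n < k) : momentFunctional (designConst m d) (X ^ n * jacobiPoly m d k) = 0 := by
  obtain ⟨l, rfl⟩ := Nat.exists_eq_add_of_lt hnk
  set A : ℝ := (m : ℝ) / 2 with hA
  set B : ℝ := (m : ℝ) * d / 2 with hB
  have hA0 : 0 < A := by positivity
  have hB0 : 0 < B := by positivity
  let q : ℝ[X] := C ((ascPochhammer ℝ (n + l)).eval B)⁻¹ *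
    ((ascPochhammer ℝ n).comp (X + C A) * (ascPochhammer ℝ l).comp (X + C (B + n)))
  have hq : q.natDegree < n + l + 1 := by
    refine Nat.lt_succ_of_le ((natDegree_C_mul_le _ _).trans (natDegree_mul_le.trans ?_))
    refine add_le_add (natDegree_comp_le.trans ?_) (natDegree_comp_le.trans ?_) <;>
      rw [natDegree_X_add_C, ascPochhammer_natDegree, mul_one]
  have hsum := alternating_sum_choose_eval_eq_zero hq
  rw [jacobiPoly, mul_left_comm, ← smul_eq_C_mul, map_smul, Finset.mul_sum, map_sum, smul_eq_mul]
  refine mul_eq_zero_of_right _ ?_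
  rw [← hsum]
  refine Finset.sum_congr rfl fun j _ => ?_
  rw [mul_left_comm, ← pow_add, momentFunctional_C_mul_X_pow, designConst_eq hm hd]
  have p1 : 0 < (ascPochhammer ℝ j).eval A := ascPochhammer_pos _ _ hA0
  have p2 : 0 < (ascPochhammer ℝ (n + j)).eval B := ascPochhammer_pos _ _ hB0
  have p3 : 0 < (ascPochhammer ℝ (n + l)).eval B := ascPochhammer_pos _ _ hB0
  have e1 : (ascPochhammer ℝ (n + j)).eval A =
      (ascPochhammer ℝ j).eval A * (ascPochhammer ℝ n).eval (j + A) := by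
    rw [add_comm n, ascPochhammer_eval_add, add_comm A]
  have e2 : (ascPochhammer ℝ (n + l)).eval B * (ascPochhammer ℝ j).eval (B + (n + l : ℕ)) =
      (ascPochhammer ℝ (n + j)).eval B * (ascPochhammer ℝ l).eval (j + (B + n)) := by
    rw [← ascPochhammer_eval_add, show n + l + j = n + j + l by ring, ascPochhammer_eval_add]
    congr 2
    push_cast
    ring
  have e3 : B - 1 + ((n + l + 1 : ℕ) : ℝ) = B + (n + l : ℕ) := by push_cast; ring
  rw [e3, ← hA, ← hB, e1]
  simp only [q, eval_mul, eval_C, eval_comp, eval_add, eval_X]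
  field_simp
  linear_combination ((n + l + 1).choose j * (ascPochhammer ℝ n).eval (j + A)) * e2

theorem momentFunctional_mul_jacobiPoly {m d : ℕ} (hm : 0 < m) (hd : 1 ≤ d) (g : ℝ[X]) {k : ℕ}
    (hg : g.natDegree < k) : momentFunctional (designConst m d) (g * jacobiPoly m d k) = 0 := by
  rw [g.as_sum_range_C_mul_X_pow, Finset.sum_mul, map_sum]
  refine Finset.sum_eq_zero fun i hi => ?_
  rw [mul_assoc, ← smul_eq_C_mul, map_smul,
    momentFunctional_X_pow_mul_jacobiPoly hm hd (by rw [Finset.mem_range] at hi; omega), smul_zero]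

theorem coeff_sum_range_C_mul_X_pow (a : ℕ → ℝ) (k n : ℕ) :
    (∑ j ∈ Finset.range (k + 1), C (a j) * X ^ j : ℝ[X]).coeff n = if n ≤ k then a n else 0 := by
  simp [finsetSum_coeff, coeff_X_pow]

theorem degree_jacobiPoly {m d : ℕ} (hm : 0 < m) (hd : 1 ≤ d) (k : ℕ) :
    (jacobiPoly m d k).degree = k := by
  have hA0 : 0 < (m : ℝ) / 2 := by positivity
  have hB0 : 0 < (m : ℝ) * d / 2 := by positivity
  have p1 : ∀ k, 0 < (ascPochhammer ℝ k).eval ((m : ℝ) / 2) := fun k => ascPochhammer_pos _ _ hA0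
  have p2 : 0 < (ascPochhammer ℝ k).eval ((m : ℝ) * d / 2 - 1 + k) := by
    -- For `k = 0` the base `md/2 - 1` may be nonpositive, but the Pochhammer symbol is empty.
    rcases Nat.eq_zero_or_pos k with rfl | hk
    · simp
    · have : (1 : ℝ) ≤ k := by exact_mod_cast hk
      exact ascPochhammer_pos _ _ (by linarith)
  refine degree_eq_of_le_of_coeff_ne_zero ?_ ?_
  · rw [← natDegree_le_iff_degree_le, natDegree_le_iff_coeff_eq_zero]
    intro n hn
    rw [jacobiPoly, coeff_C_mul, coeff_sum_range_C_mul_X_pow, if_neg (by omega), mul_zero]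
  · rw [jacobiPoly, coeff_C_mul, coeff_sum_range_C_mul_X_pow, if_pos le_rfl, Nat.choose_self]
    have := p1 k
    have : (k.factorial : ℝ) ≠ 0 := by positivity
    have : ((-1 : ℝ) ^ k) ≠ 0 := by simp
    have := p2.ne'
    simp only [Nat.cast_one, mul_one]
    positivity

theorem exists_hoggarPoly_eq {m d : ℕ} (hm : 0 < m) (hd : 1 ≤ d) {k : ℕ} (hk : 1 ≤ k) :
    ∃ s : ℝ, s ≠ 0 ∧ hoggarPoly m d k = C s * jacobiPoly m d k := by
  set A : ℝ := (m : ℝ) / 2 with hA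
  set B : ℝ := (m : ℝ) * d / 2 with hB
  have hA0 : 0 < A := by positivity
  have hB0 : 0 < B := by positivity
  have hk' : (1 : ℝ) ≤ k := by exact_mod_cast hk
  have hBk : 0 < B - 1 + k := by linarith
  have p1 : ∀ j, 0 < (ascPochhammer ℝ j).eval A := fun j => ascPochhammer_pos _ _ hA0
  have p2 : ∀ j, 0 < (ascPochhammer ℝ j).eval (B - 1 + k) := fun j => ascPochhammer_pos _ _ hBk
  have p3 : ∀ j, 0 < (ascPochhammer ℝ j).eval B := fun j => ascPochhammer_pos _ _ hB0
  have hf : (k.factorial : ℝ) ≠ 0 := by positivity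
  -- The quotient of the leading coefficients. Reversing the summation turns the falling factorials
  -- into `(A + j)_i = (A)_k / (A)_j` and its analogue for `B - 1 + k`, where `i = k - j`.
  set s : ℝ := (-1) ^ k * (ascPochhammer ℝ (2 * k)).eval B /
    ((ascPochhammer ℝ k).eval A * (ascPochhammer ℝ k).eval (B - 1 + k)) with hs
  refine ⟨s, ?_, ?_⟩
  · have h1 : ((-1 : ℝ) ^ k) ≠ 0 := by simp
    have := p1 k
    have := p2 k
    have := p3 (2 * k)
    positivity
  · rw [hoggarPoly, jacobiPoly, ← mul_assoc, ← C_mul, ← Finset.sum_range_reflect, Finset.mul_sum,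
      Finset.mul_sum]
    refine Finset.sum_congr rfl fun j hj => ?_
    obtain ⟨i, hi⟩ := Nat.exists_eq_add_of_le (Finset.mem_range_succ_iff.1 hj)
    have e0 : k + 1 - 1 - j = i := by omega
    have e1 : k - i = j := by omega
    rw [e0, e1, ← mul_assoc, ← mul_assoc, ← C_mul, ← C_mul]
    congr 2
    have hkr : (k : ℝ) = j + i := by rw [hi]; push_cast; rfl
    have d1 : (descPochhammer ℝ i).eval ((k : ℝ) + (m : ℝ) / 2 - 1) =
        (ascPochhammer ℝ i).eval (A + j) := by
      rw [descPochhammer_eval_eq_ascPochhammer]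
      congr 1
      rw [hkr, hA]
      ring
    have d2 : (descPochhammer ℝ i).eval (2 * (k : ℝ) + (m : ℝ) * d / 2 - 2) =
        (ascPochhammer ℝ i).eval (B - 1 + k + j) := by
      rw [descPochhammer_eval_eq_ascPochhammer]
      congr 1
      rw [hkr, hB]
      ring
    have c1 : (ascPochhammer ℝ k).eval A =
        (ascPochhammer ℝ j).eval A * (ascPochhammer ℝ i).eval (A + j) := by
      rw [← ascPochhammer_eval_add, hi]
    have c2 : (ascPochhammer ℝ k).eval (B - 1 + k) =
        (ascPochhammer ℝ j).eval (B - 1 + k) * (ascPochhammer ℝ i).eval (B - 1 + k + j) := by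
      rw [← ascPochhammer_eval_add, hi]
    have hch : k.choose i = k.choose j := by
      rw [← Nat.choose_symm (by omega : i ≤ k), e1]
    have hsgn : (-1 : ℝ) ^ k = (-1) ^ j * (-1) ^ i := by rw [← pow_add, hi]
    have hsq : ((-1 : ℝ) ^ j) * (-1) ^ j = 1 := by rw [← mul_pow]; simp
    have q1 := p1 k
    have q2 := p2 k
    have q3 := p1 j
    have q4 := p2 j
    have q5 : (ascPochhammer ℝ i).eval (B - 1 + k + j) ≠ 0 :=
      (ascPochhammer_pos _ _ (by positivity)).ne'
    have q6 : (ascPochhammer ℝ i).eval (A + j) ≠ 0 :=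
      (ascPochhammer_pos _ _ (by positivity)).ne'
    rw [d1, d2, hs, hch, c1, c2, hsgn, ← hA, ← hB]
    generalize (ascPochhammer ℝ j).eval (B - 1 + k) = y at *
    field_simp
    linear_combination (-((ascPochhammer ℝ (2 * k)).eval B * (k.choose j : ℝ))) * hsq

end Jacobi

/-! ### The equivalences, through the cubature error. -/

section Main

open Polynomial

theorem eq_zero_of_degree_eq {D : ℝ[X] →ₗ[ℝ] ℝ} {Q : ℕ → ℝ[X]} (hQ : ∀ k, (Q k).degree = k)
    {t : ℕ} (hD : ∀ l ≤ t, D (Q l) = 0) (g : ℝ[X]) (hg : g.natDegree ≤ t) : D g = 0 := by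
  have key : ∀ n ≤ t + 1, ∀ g : ℝ[X], (∀ i, n ≤ i → g.coeff i = 0) → D g = 0 := by
    intro n
    induction n with
    | zero =>
      intro _ g hg
      have hg0 : g = 0 := Polynomial.ext fun i => hg i (Nat.zero_le i)
      rw [hg0, map_zero]
    | succ n ih =>
      intro hn g hg
      have hlead : (Q n).coeff n ≠ 0 := coeff_ne_zero_of_eq_degree (hQ n)
      have h := ih (by omega) (g - (g.coeff n / (Q n).coeff n) • Q n) fun i hi => by
        rcases hi.eq_or_lt with rfl | hi
        · simp [hlead]
        · rw [coeff_sub, coeff_smul, hg i hi,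
            coeff_eq_zero_of_degree_lt (p := Q n) (n := i) (by rw [hQ]; exact_mod_cast hi),
            smul_zero, sub_zero]
      rwa [map_sub, map_smul, hD n (by omega), smul_zero, sub_zero] at h
  exact key (g.natDegree + 1) (by omega) g fun i hi => coeff_eq_zero_of_natDegree_lt hi

variable {F : Type} [NormedDivisionRing F] [StarRing F] [InnerProductSpace ℝ F]
  [EuclideanDivisionRing F] [FiniteDimensional ℝ F] {d : ℕ}
  [MeasurableSpace (FVec F d)] [BorelSpace (FVec F d)]

theorem integral_eval_norm_herm_sq (hd : 1 ≤ d) (g : ℝ[X]) (y : FVec F d) (hy : ‖y‖ = 1) :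
    ∫ x : Metric.sphere (0 : FVec F d) 1, g.eval (‖herm (x : FVec F d) y‖ ^ 2)
      ∂surfaceMeasure (FVec F d) =
      momentFunctional (designConst (Module.finrank ℝ F) d) g := by
  simp only [momentFunctional_eq_sum, eval_eq_sum_range]
  have hint : ∀ i, Integrable (fun x : Metric.sphere (0 : FVec F d) 1 =>
      (‖herm (x : FVec F d) y‖ ^ 2) ^ i) (surfaceMeasure (FVec F d)) := fun i =>
    integrable_of_continuous_sphere ((continuous_norm_herm_sq y).pow i)
  rw [integral_finsetSum _ fun i _ => (hint i).const_mul (g.coeff i)]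
  refine Finset.sum_congr rfl fun i _ => ?_
  rw [integral_const_mul]
  simp only [← pow_mul]
  rw [integral_norm_herm_pow hd, hy, one_pow, mul_one]

theorem integral_inducedMeasure (hd : 1 ≤ d) (g : ℝ[X]) :
    ∫ s, g.eval s ∂inducedMeasure F d =
      momentFunctional (designConst (Module.finrank ℝ F) d) g := by
  have := nontrivial_FVec F hd
  have hc : Continuous fun z : Metric.sphere (0 : FVec F d) 1 × Metric.sphere (0 : FVec F d) 1 =>
      ‖herm (z.1 : FVec F d) (z.2 : FVec F d)‖ ^ 2 :=
    (continuous_norm.comp ((continuous_herm (F := F) (d := d)).comp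
      ((continuous_subtype_val.comp continuous_fst).prodMk
        (continuous_subtype_val.comp continuous_snd)))).pow 2
  rw [inducedMeasure, integral_map hc.measurable.aemeasurable
    g.continuous.aestronglyMeasurable, integral_prod_symm]
  · have h := fun y : Metric.sphere (0 : FVec F d) 1 =>
      integral_eval_norm_herm_sq hd g (y : FVec F d) (norm_eq_of_mem_sphere y)
    simp [h]
  · exact (g.continuous.comp hc).integrable_of_hasCompactSupport
      (HasCompactSupport.of_compactSpace _)

theorem isOrthogonalFamily_jacobiPoly (hd : 1 ≤ d) :
    IsOrthogonalFamily (inducedMeasure F d) (jacobiPoly (Module.finrank ℝ F) d) := by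
  have hm : 0 < Module.finrank ℝ F := Module.finrank_pos
  refine ⟨degree_jacobiPoly hm hd, fun j k hjk => ?_⟩
  have hnd : ∀ k, (jacobiPoly (Module.finrank ℝ F) d k).natDegree = k := fun k =>
    natDegree_eq_of_degree_eq_some (degree_jacobiPoly hm hd k)
  simp only [← eval_mul]
  rw [integral_inducedMeasure hd]
  rcases hjk.lt_or_gt with h | h
  · exact momentFunctional_mul_jacobiPoly hm hd _ (by rwa [hnd])
  · rw [mul_comm]
    exact momentFunctional_mul_jacobiPoly hm hd _ (by rwa [hnd])

theorem integral_integral_projMeasure (hd : 1 ≤ d) (g : ℝ[X]) :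
    ∫ p : FProj F d, ∫ q : FProj F d, g.eval (1 - lineDist p q ^ 2) ∂projMeasure F d
      ∂projMeasure F d = momentFunctional (designConst (Module.finrank ℝ F) d) g := by
  have := nontrivial_FVec F hd
  have h : ∀ p : FProj F d, ∫ q : FProj F d, g.eval (1 - lineDist p q ^ 2) ∂projMeasure F d =
      momentFunctional (designConst (Module.finrank ℝ F) d) g := fun p => by
    simp only [one_sub_lineDist_sq]
    have hmeas : Measurable fun q => g.eval (cosSq p q) :=
      g.continuous.measurable.comp (measurable_cosSq p)
    rw [integral_projMeasure hmeas]
    obtain ⟨x, rfl⟩ := lineOfSphere_surjective p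
    rw [← integral_eval_norm_herm_sq hd g (x : FVec F d) (norm_eq_of_mem_sphere x)]
    refine integral_congr_ae (Filter.Eventually.of_forall fun y => ?_)
    simp only [cosSq_lineOfSphere]
    rw [norm_herm_comm]
  have : IsProbabilityMeasure (projMeasure F d) :=
    Measure.isProbabilityMeasure_map measurable_lineOfSphere.aemeasurable
  simp [h]

/-- The error of the cubature rule with nodes `pⱼ` and weights `wⱼ`. -/
def cubatureError {ι : Type} [Fintype ι] (w : ι → ℝ) (p : ι → FProj F d) : ℝ[X] →ₗ[ℝ] ℝ where
  toFun g := (∑ j, w j) ^ 2 * momentFunctional (designConst (Module.finrank ℝ F) d) g -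
    ∑ j, ∑ k, w j * w k * g.eval (cosSq (p j) (p k))
  map_add' f g := by
    simp only [map_add, eval_add, mul_add, Finset.sum_add_distrib]
    ring
  map_smul' r g := by
    simp only [map_smul, eval_smul, smul_eq_mul, RingHom.id_apply, mul_sub, Finset.mul_sum]
    congr 1
    · ring
    · refine Finset.sum_congr rfl fun j _ => Finset.sum_congr rfl fun k _ => ?_
      ring

theorem isCubatureDesign_iff (hd : 1 ≤ d) (t : ℕ) {ι : Type} [Fintype ι] (w : ι → ℝ)
    (p : ι → FProj F d) (hw : ∑ j, w j ≠ 0) :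
    IsCubatureDesign lineDist (projMeasure F d) (fun r => 1 - r ^ 2) t w p ↔
      ∀ g : ℝ[X], g.natDegree ≤ t → cubatureError w p g = 0 := by
  refine forall₂_congr fun g _ => ?_
  rw [integral_integral_projMeasure hd]
  simp only [one_sub_lineDist_sq, cubatureError, LinearMap.coe_mk, AddHom.coe_mk]
  rw [sub_eq_zero, eq_inv_mul_iff_mul_eq₀ (pow_ne_zero 2 hw)]

/-- Orthogonality to the nonzero constant `Q 0` makes the mean of `Q l` vanish for `l ≥ 1`, so its
cubature error is minus the design sum. Constants have error zero, and `Q 0, …, Q t` span the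
polynomials of degree at most `t`. -/
theorem designSumsVanish_iff (hd : 1 ≤ d) (t : ℕ) {ι : Type} [Fintype ι] (w : ι → ℝ)
    (p : ι → FProj F d) (Q : ℕ → ℝ[X]) (hQ : IsOrthogonalFamily (inducedMeasure F d) Q) :
    DesignSumsVanish Q t w p ↔ ∀ g : ℝ[X], g.natDegree ≤ t → cubatureError w p g = 0 := by
  obtain ⟨hdeg, horth⟩ := hQ
  have hQ0 : Q 0 = C ((Q 0).coeff 0) := eq_C_of_degree_eq_zero (hdeg 0)
  have hc0 : (Q 0).coeff 0 ≠ 0 := coeff_ne_zero_of_eq_degree (hdeg 0)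
  have hmom : ∀ l, 1 ≤ l → momentFunctional (designConst (Module.finrank ℝ F) d) (Q l) = 0 := by
    intro l hl
    have h := horth l 0 (by omega)
    simp only [← eval_mul] at h
    rw [integral_inducedMeasure hd, mul_comm, hQ0, ← smul_eq_C_mul, map_smul] at h
    exact (smul_eq_zero.1 h).resolve_left hc0
  have herr : ∀ l, 1 ≤ l → (cubatureError w p (Q l) = 0 ↔
      ∑ j, ∑ k, w j * w k * (Q l).eval (cosSq (p j) (p k)) = 0) := fun l hl => by
    simp [cubatureError, hmom l hl]
  constructor
  · refine fun h g hg => eq_zero_of_degree_eq hdeg (fun l hl => ?_) g hg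
    rcases Nat.eq_zero_or_pos l with rfl | hl0
    · have h1 : cubatureError w p 1 = 0 := by
        have h2 := momentFunctional_X_pow (designConst (Module.finrank ℝ F) d) 0
        rw [pow_zero] at h2
        simp [cubatureError, h2, designConst, pow_two, Finset.sum_mul_sum]
      rw [hQ0, ← mul_one (C _), ← smul_eq_C_mul, map_smul, h1, smul_zero]
    · exact (herr l hl0).2 (h l hl0 hl)
  · exact fun h l hl hlt => (herr l hl).1 (h _ ((natDegree_eq_of_degree_eq_some (hdeg l)).trans_le
      hlt))

/-- The error on `X ^ r` vanishes exactly when the reweighted `(r,r)`-design identity holds, since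
`cos² θ` to the power `r` divides the weights by `‖vⱼ‖^{2r}‖vₖ‖^{2r}`. The case `r = t` is the
design condition itself, and it implies the cases `r < t`. -/
theorem design_iff_cubatureError (hd : 1 ≤ d) (t : ℕ) {ι : Type} [Fintype ι] (w : ι → ℝ)
    (v : ι → FVec F d) (hv : ∀ j, v j ≠ 0) :
    (∑ j, ∑ k, w j * w k * ‖herm (v j) (v k)‖ ^ (2 * t) =
      designConst (Module.finrank ℝ F) d t * (∑ l, w l * ‖v l‖ ^ (2 * t)) ^ 2) ↔
    ∀ g : ℝ[X], g.natDegree ≤ t →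
      cubatureError (fun j => w j * ‖v j‖ ^ (2 * t)) (fun j => line (v j) (hv j)) g = 0 := by
  have hv' : ∀ j, ‖v j‖ ≠ 0 := fun j => norm_ne_zero_iff.2 (hv j)
  have hX : ∀ r ≤ t, cubatureError (fun j => w j * ‖v j‖ ^ (2 * t)) (fun j => line (v j) (hv j))
      (X ^ r) = (∑ l, w l * ‖v l‖ ^ (2 * t)) ^ 2 * designConst (Module.finrank ℝ F) d r -
      ∑ j, ∑ k, (w j * ‖v j‖ ^ (2 * (t - r))) * (w k * ‖v k‖ ^ (2 * (t - r))) *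
      ‖herm (v j) (v k)‖ ^ (2 * r) := by
    intro r hr
    obtain ⟨s, rfl⟩ := Nat.exists_eq_add_of_le hr
    simp only [cubatureError, LinearMap.coe_mk, AddHom.coe_mk, momentFunctional_X_pow, eval_pow,
      eval_X, cosSq_line, add_tsub_cancel_left]
    congr 1
    refine Finset.sum_congr rfl fun j _ => Finset.sum_congr rfl fun k _ => ?_
    have h1 := hv' j
    have h2 := hv' k
    rw [div_pow, mul_pow, mul_add, pow_add, pow_add, pow_mul ‖v j‖ 2 r, pow_mul ‖v k‖ 2 r,
      pow_mul ‖herm (v j) (v k)‖ 2 r]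
    field_simp
  constructor
  · intro h g hg
    refine eq_zero_of_degree_eq (Q := fun k => X ^ k) (fun k => degree_X_pow k)
      (fun r hr => ?_) g hg
    rw [hX r hr, design_sum_of_le hd hr w v h]
    ring
  · intro h
    have h1 := h (X ^ t) (natDegree_X_pow_le t)
    rw [hX t le_rfl] at h1
    simp only [tsub_self, mul_zero, pow_zero, mul_one] at h1
    linarith

omit [EuclideanDivisionRing F] [MeasurableSpace (FVec F d)] [BorelSpace (FVec F d)] in
theorem designSumsVanish_hoggarPoly_iff (hd : 1 ≤ d) (t : ℕ) {ι : Type} [Fintype ι] (w : ι → ℝ)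
    (p : ι → FProj F d) : DesignSumsVanish (hoggarPoly (Module.finrank ℝ F) d) t w p ↔
      DesignSumsVanish (jacobiPoly (Module.finrank ℝ F) d) t w p := by
  refine forall₃_congr fun l hl _ => ?_
  obtain ⟨s, hs, h⟩ := exists_hoggarPoly_eq (m := Module.finrank ℝ F) Module.finrank_pos hd hl
  have h2 : ∑ j, ∑ k, w j * w k * (hoggarPoly (Module.finrank ℝ F) d l).eval (cosSq (p j) (p k)) =
      s * ∑ j, ∑ k, w j * w k *
        (jacobiPoly (Module.finrank ℝ F) d l).eval (cosSq (p j) (p k)) := by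
    simp only [h, eval_mul, eval_C, Finset.mul_sum]
    refine Finset.sum_congr rfl fun j _ => Finset.sum_congr rfl fun k _ => ?_
    ring
  rw [h2, mul_eq_zero, or_iff_right hs]

theorem projective_designs (hd : 1 ≤ d) {m : ℕ} (hm : Module.finrank ℝ F = m) :
    IsDelsarteSpace (lineDist (F := F) (d := d)) (projMeasure F d) ∧
      IsOrthogonalFamily (inducedMeasure F d) (jacobiPoly m d) ∧
      ∀ (t : ℕ), 1 ≤ t → ∀ (ι : Type) [Fintype ι] (w : ι → ℝ) (v : ι → FVec F d)
        (hv : ∀ j, v j ≠ 0), (∀ j, 0 ≤ w j) → 0 < ∑ j, w j →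
        ((∑ j, ∑ k, w j * w k * ‖herm (v j) (v k)‖ ^ (2 * t) =
            designConst m d t * (∑ l, w l * ‖v l‖ ^ (2 * t)) ^ 2) ↔
          DesignSumsVanish (hoggarPoly m d) t (fun j => w j * ‖v j‖ ^ (2 * t))
            (fun j => line (v j) (hv j))) ∧
        ((∑ j, ∑ k, w j * w k * ‖herm (v j) (v k)‖ ^ (2 * t) =
            designConst m d t * (∑ l, w l * ‖v l‖ ^ (2 * t)) ^ 2) ↔
          IsCubatureDesign lineDist (projMeasure F d) (fun r => 1 - r ^ 2) t
            (fun j => w j * ‖v j‖ ^ (2 * t)) (fun j => line (v j) (hv j))) ∧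
        ∀ Q : ℕ → ℝ[X], IsOrthogonalFamily (inducedMeasure F d) Q →
          ((∑ j, ∑ k, w j * w k * ‖herm (v j) (v k)‖ ^ (2 * t) =
              designConst m d t * (∑ l, w l * ‖v l‖ ^ (2 * t)) ^ 2) ↔
            DesignSumsVanish Q t (fun j => w j * ‖v j‖ ^ (2 * t))
              (fun j => line (v j) (hv j))) := by
  subst hm
  refine ⟨isDelsarteSpace_FProj hd, isOrthogonalFamily_jacobiPoly hd, ?_⟩
  intro t _ ι _ w v hv hw hsum
  have hW : ∑ j, w j * ‖v j‖ ^ (2 * t) ≠ 0 := by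
    obtain ⟨j, hj, hjw⟩ := Finset.exists_lt_of_sum_lt (s := Finset.univ)
      (f := fun _ : ι => (0 : ℝ)) (g := w) (by simpa using hsum)
    refine (Finset.sum_pos' (fun i _ => mul_nonneg (hw i) (by positivity)) ⟨j, hj, ?_⟩).ne'
    have := norm_pos_iff.2 (hv j)
    exact mul_pos hjw (by positivity)
  rw [design_iff_cubatureError hd t w v hv]
  refine ⟨?_, (isCubatureDesign_iff hd t _ _ hW).symm, fun Q hQ =>
    (designSumsVanish_iff hd t _ _ Q hQ).symm⟩
  rw [designSumsVanish_hoggarPoly_iff hd]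
  exact (designSumsVanish_iff hd t _ _ _ (isOrthogonalFamily_jacobiPoly hd)).symm

end Main

end

/-! ### Specialisation to the three fields. -/

theorem mainTheorem3 (d : ℕ) (hd : 1 ≤ d) :
    -- the case `𝔽 = ℝ`
    (IsDelsarteSpace (lineDist (F := ℝ) (d := d)) (projMeasure ℝ d) ∧
      IsOrthogonalFamily (inducedMeasure ℝ d) (jacobiPoly 1 d) ∧
      ∀ (t : ℕ), 1 ≤ t → ∀ (ι : Type) [Fintype ι] (w : ι → ℝ) (v : ι → FVec ℝ d)
        (hv : ∀ j, v j ≠ 0), (∀ j, 0 ≤ w j) → 0 < ∑ j, w j →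
        (IsSphericalDesign ℝ t w v ↔
          IsProjectiveDesign ℝ t (fun j => w j * ‖v j‖ ^ (2 * t)) (fun j => line (v j) (hv j))) ∧
        (IsSphericalDesign ℝ t w v ↔
          IsCubatureDesign lineDist (projMeasure ℝ d) (fun r => 1 - r ^ 2) t
            (fun j => w j * ‖v j‖ ^ (2 * t)) (fun j => line (v j) (hv j))) ∧
        ∀ Q : ℕ → ℝ[X], IsOrthogonalFamily (inducedMeasure ℝ d) Q →
          (IsSphericalDesign ℝ t w v ↔
            DesignSumsVanish Q t (fun j => w j * ‖v j‖ ^ (2 * t))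
              (fun j => line (v j) (hv j)))) ∧
    -- the case `𝔽 = ℂ`
    (IsDelsarteSpace (lineDist (F := ℂ) (d := d)) (projMeasure ℂ d) ∧
      IsOrthogonalFamily (inducedMeasure ℂ d) (jacobiPoly 2 d) ∧
      ∀ (t : ℕ), 1 ≤ t → ∀ (ι : Type) [Fintype ι] (w : ι → ℝ) (v : ι → FVec ℂ d)
        (hv : ∀ j, v j ≠ 0), (∀ j, 0 ≤ w j) → 0 < ∑ j, w j →
        (IsSphericalDesign ℂ t w v ↔
          IsProjectiveDesign ℂ t (fun j => w j * ‖v j‖ ^ (2 * t)) (fun j => line (v j) (hv j))) ∧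
        (IsSphericalDesign ℂ t w v ↔
          IsCubatureDesign lineDist (projMeasure ℂ d) (fun r => 1 - r ^ 2) t
            (fun j => w j * ‖v j‖ ^ (2 * t)) (fun j => line (v j) (hv j))) ∧
        ∀ Q : ℕ → ℝ[X], IsOrthogonalFamily (inducedMeasure ℂ d) Q →
          (IsSphericalDesign ℂ t w v ↔
            DesignSumsVanish Q t (fun j => w j * ‖v j‖ ^ (2 * t))
              (fun j => line (v j) (hv j)))) ∧
    -- the case `𝔽 = ℍ`
    (IsDelsarteSpace (lineDist (F := ℍ[ℝ]) (d := d)) (projMeasure ℍ[ℝ] d) ∧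
      IsOrthogonalFamily (inducedMeasure ℍ[ℝ] d) (jacobiPoly 4 d) ∧
      ∀ (t : ℕ), 1 ≤ t → ∀ (ι : Type) [Fintype ι] (w : ι → ℝ) (v : ι → FVec ℍ[ℝ] d)
        (hv : ∀ j, v j ≠ 0), (∀ j, 0 ≤ w j) → 0 < ∑ j, w j →
        (IsSphericalDesign ℍ[ℝ] t w v ↔
          IsProjectiveDesign ℍ[ℝ] t (fun j => w j * ‖v j‖ ^ (2 * t))
            (fun j => line (v j) (hv j))) ∧
        (IsSphericalDesign ℍ[ℝ] t w v ↔
          IsCubatureDesign lineDist (projMeasure ℍ[ℝ] d) (fun r => 1 - r ^ 2) t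
            (fun j => w j * ‖v j‖ ^ (2 * t)) (fun j => line (v j) (hv j))) ∧
        ∀ Q : ℕ → ℝ[X], IsOrthogonalFamily (inducedMeasure ℍ[ℝ] d) Q →
          (IsSphericalDesign ℍ[ℝ] t w v ↔
            DesignSumsVanish Q t (fun j => w j * ‖v j‖ ^ (2 * t))
              (fun j => line (v j) (hv j)))) := by
  have h1 : Module.finrank ℝ ℝ = 1 := Module.finrank_self ℝ
  have h2 : Module.finrank ℝ ℂ = 2 := Complex.finrank_real_complex
  have h4 : Module.finrank ℝ ℍ[ℝ] = 4 := Quaternion.finrank_eq_four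
  refine ⟨?_, ?_, ?_⟩
  · simpa only [IsSphericalDesign, IsProjectiveDesign, h1] using projective_designs (F := ℝ) hd h1
  · simpa only [IsSphericalDesign, IsProjectiveDesign, h2] using projective_designs (F := ℂ) hd h2
  · simpa only [IsSphericalDesign, IsProjectiveDesign, h4] using
      projective_designs (F := ℍ[ℝ]) hd h4
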